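/- Let $m\ge 1$ be an integer. For a real symmetric matrix $B\in\mathbb R^{k\times k}$ let $\mathrm{tr}_m^G(B)=\frac1m\sum_{j=1}^m z_j^TBz_j$, with $z_1,\dots,z_m$ i.i.d. standard Gaussian vectors in $\mathbb R^k$, be the Gaussian trace estimator with $m$ samples. For a nonzero symmetric positive semidefinite (SPSD) matrix $A$, the effective rank is $\mathrm{tr}(A)/\|A\|_2$, where $\|A\|_2$ is the spectral norm. For $\mu\ge 1$ let $$A_{\mathrm{rel}}(\mu)=\frac1\mu\,\mathrm{diag}\bigl(\underbrace{1,\dots,1}_{\lfloor\mu\rfloor},\ \mu-\lfloor\mu\rfloor,\ 0,\dots,0\bigr),$$ of any size $N\times N$ with $N\ge\mu$ (if $N=\mu$, there are only the $\mu$ ones on the diagonal). Theorem. For every $m\ge1$ and every $\mu\ge 1$ there is a real number $\varepsilon_{\mathrm{rel}}$, depending only on $m$ and $\mu$, such that for every $n$, every nonzero SPSD matrix $A\in\mathbb R^{n\times n}$ of effective rank $\mu$, every size $N\ge\mu$ of $A_{\mathrm{rel}}(\mu)$, and every $\varepsilon\ge\varepsilon_{\mathrm{rel}}$, $$\Pr\bigl(|\mathrm{tr}_m^G(A)-\mathrm{tr}(A)|\ge\varepsilon\,\mathrm{tr}(A)\bigr)\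 \le\ \Pr\bigl(|\mathrm{tr}_m^G(A_{\mathrm{rel}}(\mu))-1|\ge\varepsilon\bigr)\ \le\ \Pr\bigl(|X-1|\ge\varepsilon\bigr),$$ where $X\sim\mathrm{Gamma}\bigl(\tfrac{m\mu}2,\tfrac{m\mu}2\bigr)$ (shape and rate). -/

import Mathlib

open MeasureTheory ProbabilityTheory

/-- The spectral norm `‖A‖₂`: the operator norm of `x ↦ A x` on Euclidean space. -/
noncomputable def specNorm {n : ℕ} (A : Matrix (Fin n) (Fin n) ℝ) : ℝ :=
  ‖Matrix.toEuclideanCLM (n := Fin n) (𝕜 := ℝ) A‖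

/-- The effective rank `tr A / ‖A‖₂` (meaningful for nonzero positive semidefinite `A`). -/
noncomputable def effectiveRank {n : ℕ} (A : Matrix (Fin n) (Fin n) ℝ) : ℝ :=
  A.trace / specNorm A

/-- The trace estimator `(1 / m) ∑ⱼ zⱼᵀ A zⱼ` evaluated at sample vectors `z₁, …, zₘ`.
It is the Gaussian trace estimator when the `zⱼ` are i.i.d. standard Gaussian vectors. -/
noncomputable def traceEstimator {n m : ℕ} (A : Matrix (Fin n) (Fin n) ℝ)
    (z : Fin m → EuclideanSpace ℝ (Fin n)) : ℝ :=
  (1 / (m : ℝ)) * ∑ j, dotProduct (z j).ofLp (A.mulVec (z j).ofLp)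

/-- The `m` random vectors `zⱼ` are i.i.d. standard Gaussian in `ℝⁿ` under `P`. -/
structure IsGaussianSample {Ω : Type*} [MeasurableSpace Ω] (P : Measure Ω) {n m : ℕ}
    (z : Fin m → Ω → EuclideanSpace ℝ (Fin n)) : Prop where
  hasLaw : ∀ j, HasLaw (z j) (stdGaussian (EuclideanSpace ℝ (Fin n))) P
  indep : iIndepFun z P

/-- The extremal matrix `(1 / μ) diag(1, …, 1, μ - ⌊μ⌋, 0, …, 0)` of size `N × N`, with `⌊μ⌋`
ones; it is used for `N ≥ μ`, so that all of its nonzero entries fit. -/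
noncomputable def extremalMatrix (N : ℕ) (μ : ℝ) : Matrix (Fin N) (Fin N) ℝ :=
  (1 / μ) • Matrix.diagonal fun i : Fin N =>
    if (i : ℕ) < ⌊μ⌋₊ then 1 else if (i : ℕ) = ⌊μ⌋₊ then μ - (⌊μ⌋₊ : ℝ) else 0

section

open Set Filter Topology

set_option linter.unusedSectionVars false

/-! Expanding the Gaussian vectors in an eigenbasis of A shows that (m / (2‖A‖)) tr_m(A) has the law
of S = ∑ λ_k u_k, where the u_k are independent Gamma(α, 1) variables with α = m/2 and λ_k = (k-th
eigenvalue)/‖A‖. These weights lie in [0, 1], attain 1 and have sum μ. For ε > 1 the lower tail is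
empty, so the claim concerns P(S ≥ x) at x = (m/2) μ (1 + ε): beyond a threshold independent of the
number of weights, concentrating the weights at fixed total increases this tail.

The tail is smoothed to E φ(x - S) with η = -φ' supported in [0, 1]. Moving weight from j to i at
constant mean changes it at rate -(λ_i - λ_j)/(p_i p_j) · E[u_i u_j η'(x - S)]
(`hasDerivAt_integral_φ_transfer`). For a set B of coordinates containing i and j, put L = ∑_B λ_k
u_k and K = u_i u_j η(x - S)/L. Integration by parts along the radial field of B gives E[u_i u_j η']
= -E[K (∑_B u_k - ∑_B p_k - 1)] (`integral_weight_mul_η'`), so it remains to see that this last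
expectation is nonnegative.

If B is everything, S ≤ ∑ u_k makes the integrand nonnegative once x ≥ ∑ p_k + 2, but this threshold
grows with the number of coordinates. Uniformity comes from letting B contain i, j and the boundedly
many weights at least 1/32 (`exists_integral_radialKernel_nonneg`). Where L is large the integrand
is at least u_i u_j η / 2, and that region contributes at least a constant times e^{-2x}. Where L is
small, the small weights outside B must produce nearly all of x; a Chernoff bound makes this much
rarer than e^{-2x}, even after paying the factor λ_i^{-(α+1)} caused by the denominator.

Repeated transfers towards the largest fractional weight leave at most one fractional weight, and
the law is then that of the extremal matrix. For the second inequality, the summand f·Gamma(α) with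
fractional weight f is split into f·Gamma(fα) + f·Gamma((1-f)α). Moving all the weight of the second
piece to the first yields Gamma(fα), hence Gamma(μα) in total; only three coordinates occur, so B
can be everything. -/

/-! ### The gamma distribution with unit rate -/

theorem isProbabilityMeasure_gammaMeasure_one {p : ℝ} (hp : 0 < p) :
    IsProbabilityMeasure (gammaMeasure p 1) :=
  isProbabilityMeasure_gammaMeasure hp one_pos

instance {p : ℝ} [hp : Fact (0 < p)] : IsProbabilityMeasure (gammaMeasure p 1) :=
  isProbabilityMeasure_gammaMeasure hp.out one_pos

theorem gammaPDF_one_eq_indicator (p : ℝ) :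
    gammaPDF p 1 =ᵐ[volume] (Ioi (0 : ℝ)).indicator fun u =>
      ENNReal.ofReal (1 / Real.Gamma p * u ^ (p - 1) * Real.exp (-u)) := by
  have h0 : ∀ᵐ u : ℝ, u ≠ 0 := by simp [ae_iff]
  filter_upwards [h0] with u hu
  rcases lt_or_gt_of_ne hu with h | h
  · rw [gammaPDF_of_neg h, indicator_of_notMem (by simpa using h.le)]
  · rw [gammaPDF_of_nonneg h.le, indicator_of_mem (by simpa using h)]
    simp

theorem gammaMeasure_one_eq (p : ℝ) :
    gammaMeasure p 1 = (volume.restrict (Ioi (0 : ℝ))).withDensity fun u =>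
      ENNReal.ofReal (1 / Real.Gamma p * u ^ (p - 1) * Real.exp (-u)) := by
  rw [gammaMeasure, withDensity_congr_ae (gammaPDF_one_eq_indicator p),
    withDensity_indicator measurableSet_Ioi]

theorem gammaDensity_nonneg {p : ℝ} (hp : 0 < p) {u : ℝ} (hu : 0 < u) :
    0 ≤ 1 / Real.Gamma p * u ^ (p - 1) * Real.exp (-u) := by
  have := Real.Gamma_pos_of_pos hp
  positivity

theorem lintegral_gammaMeasure_one (p : ℝ) {F : ℝ → ENNReal} (hF : Measurable F) :
    ∫⁻ u, F u ∂gammaMeasure p 1 = ∫⁻ u in Ioi 0,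
      ENNReal.ofReal (1 / Real.Gamma p * u ^ (p - 1) * Real.exp (-u)) * F u := by
  rw [gammaMeasure_one_eq, lintegral_withDensity_eq_lintegral_mul _ (by fun_prop) hF]
  rfl

theorem integral_gammaMeasure_one {E : Type*} [NormedAddCommGroup E] [NormedSpace ℝ E]
    {p : ℝ} (hp : 0 < p) (F : ℝ → E) :
    ∫ u, F u ∂gammaMeasure p 1 = ∫ u in Ioi 0,
      (1 / Real.Gamma p * u ^ (p - 1) * Real.exp (-u)) • F u := by
  rw [gammaMeasure_one_eq, integral_withDensity_eq_integral_toReal_smul (by fun_prop) (by simp)]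
  refine setIntegral_congr_fun measurableSet_Ioi fun u hu => ?_
  rw [ENNReal.toReal_ofReal (gammaDensity_nonneg hp hu)]

theorem integrable_gammaMeasure_one_iff {E : Type*} [NormedAddCommGroup E] [NormedSpace ℝ E]
    {p : ℝ} (hp : 0 < p) (F : ℝ → E) :
    Integrable F (gammaMeasure p 1) ↔ IntegrableOn (fun u =>
      (1 / Real.Gamma p * u ^ (p - 1) * Real.exp (-u)) • F u) (Ioi 0) := by
  rw [gammaMeasure_one_eq, integrable_withDensity_iff_integrable_smul' (by fun_prop) (by simp)]
  refine integrableOn_congr_fun (fun u hu => ?_) measurableSet_Ioi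
  rw [ENNReal.toReal_ofReal (gammaDensity_nonneg hp hu)]

theorem gammaMeasure_one_ae_pos (p : ℝ) : ∀ᵐ u ∂gammaMeasure p 1, 0 < u := by
  rw [gammaMeasure_one_eq]
  refine withDensity_absolutelyContinuous _ _ ?_
  exact ae_restrict_mem measurableSet_Ioi

/-- Moment generating function of the gamma distribution with unit rate. -/
theorem integral_exp_mul_gammaMeasure_one {p s : ℝ} (hp : 0 < p) (hs : s < 1) :
    ∫ u, Real.exp (s * u) ∂gammaMeasure p 1 = (1 - s) ^ (-p) := by
  rw [integral_gammaMeasure_one hp]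
  have h := Real.integral_rpow_mul_exp_neg_mul_Ioi hp (sub_pos.2 hs)
  have hΓ := (Real.Gamma_pos_of_pos hp).ne'
  calc _ = ∫ u in Ioi (0 : ℝ), 1 / Real.Gamma p * (u ^ (p - 1) * Real.exp (-((1 - s) * u))) := by
        refine setIntegral_congr_fun measurableSet_Ioi fun u _ => ?_
        simp only [smul_eq_mul]
        rw [show -((1 - s) * u) = -u + s * u by ring, Real.exp_add]; ring
    _ = _ := by
        rw [integral_const_mul, h, Real.div_rpow zero_le_one (sub_pos.2 hs).le,
          Real.one_rpow, Real.rpow_neg (sub_pos.2 hs).le]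
        field_simp

/-- The Bochner integral of a non-integrable function is 0, whereas the formula above gives a
positive value. -/
theorem integrable_exp_mul_gammaMeasure_one {p s : ℝ} (hp : 0 < p) (hs : s < 1) :
    Integrable (fun u => Real.exp (s * u)) (gammaMeasure p 1) := by
  by_contra h
  have h1 := integral_exp_mul_gammaMeasure_one hp hs
  rw [integral_undef h] at h1
  have : 0 < (1 - s) ^ (-p) := Real.rpow_pos_of_pos (sub_pos.2 hs) _
  linarith

theorem memLp_id_gammaMeasure_one {p : ℝ} (hp : 0 < p) :
    MemLp (fun u : ℝ => u) 2 (gammaMeasure p 1) := by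
  rw [memLp_two_iff_integrable_sq (by fun_prop)]
  -- The constant 8 comes from u²/8 ≤ exp (u/2) for u ≥ 0.
  refine ((integrable_exp_mul_gammaMeasure_one hp (s := 1 / 2) (by norm_num)).const_mul 8).mono'
    (by fun_prop) ?_
  filter_upwards [gammaMeasure_one_ae_pos p] with u hu
  rw [Real.norm_of_nonneg (by positivity)]
  have := Real.quadratic_le_exp_of_nonneg (x := 1 / 2 * u) (by positivity)
  nlinarith

theorem integrable_id_gammaMeasure_one {p : ℝ} (hp : 0 < p) :
    Integrable (fun u : ℝ => u) (gammaMeasure p 1) := by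
  have := isProbabilityMeasure_gammaMeasure_one hp
  exact (memLp_id_gammaMeasure_one hp).integrable (by norm_num)

/-- Integration by parts for the gamma distribution. -/
theorem integral_sub_mul_gammaMeasure_one {p C : ℝ} (hp : 0 < p) {F F' : ℝ → ℝ}
    (hF : ∀ u, 0 < u → HasDerivAt F (F' u) u) (hb : ∀ u, 0 < u → |F u| ≤ C)
    (hb' : ∀ u, 0 < u → |u * F' u| ≤ C * (1 + u)) :
    ∫ u, (u - p) * F u ∂gammaMeasure p 1 = ∫ u, u * F' u ∂gammaMeasure p 1 := by
  have := isProbabilityMeasure_gammaMeasure_one hp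
  have hid := integrable_id_gammaMeasure_one hp
  have haemeas : ∀ {G H : ℝ → ℝ}, (∀ u, 0 < u → G u = H u) → Measurable H →
      AEStronglyMeasurable G (gammaMeasure p 1) := by
    intro G H h hH
    refine hH.aestronglyMeasurable.congr ?_
    filter_upwards [gammaMeasure_one_ae_pos p] with u hu using (h u hu).symm
  have hcont : ContinuousOn F (Ioi 0) := fun u hu => (hF u hu).continuousAt.continuousWithinAt
  have hmF : AEStronglyMeasurable F (gammaMeasure p 1) := by
    rw [gammaMeasure_one_eq]
    exact (hcont.aestronglyMeasurable measurableSet_Ioi).mono_ac (withDensity_absolutelyContinuous _ _)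
  have hmF' : AEStronglyMeasurable F' (gammaMeasure p 1) :=
    haemeas (H := deriv F) (fun u hu => (hF u hu).deriv.symm) (measurable_deriv F)
  have hi1 : Integrable (fun u => (u - p) * F u) (gammaMeasure p 1) := by
    refine (hid.sub (integrable_const p)).mul_bdd (c := C) hmF ?_
    filter_upwards [gammaMeasure_one_ae_pos p] with u hu using hb u hu
  have hi2 : Integrable (fun u => u * F' u) (gammaMeasure p 1) := by
    refine (((integrable_const 1).add hid).const_mul C).mono'
      (aestronglyMeasurable_id.mul hmF') ?_
    filter_upwards [gammaMeasure_one_ae_pos p] with u hu using hb' u hu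
  rw [← sub_eq_zero, ← integral_sub hi1 hi2]
  have hi := hi1.sub hi2
  have hi' := (integrable_gammaMeasure_one_iff hp _).1 hi
  change ∫ u, ((fun u => (u - p) * F u) - fun u => u * F' u) u ∂_ = 0
  rw [integral_gammaMeasure_one hp]
  have hΓ := (Real.Gamma_pos_of_pos hp)
  have hC : 0 ≤ C := (abs_nonneg _).trans (hb 1 one_pos)
  have hbound : ∀ u, 0 < u → ‖1 / Real.Gamma p * u ^ p * Real.exp (-u) * F u‖ ≤
      C / Real.Gamma p * (u ^ p * Real.exp (-u)) := by
    intro u hu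
    rw [norm_mul, Real.norm_eq_abs, Real.norm_eq_abs, abs_of_nonneg (by positivity)]
    calc _ ≤ 1 / Real.Gamma p * u ^ p * Real.exp (-u) * C := by
          gcongr
          exact hb u hu
      _ = _ := by ring
  -- The difference of the two integrands times the density is the derivative of -u^p e^{-u}
  -- F(u)/Γ(p). F is uncontrolled at 0, so this primitive is set to 0 there; continuity then follows
  -- from the factor u^p and the bound on F.
  have key := integral_Ioi_of_hasDerivAt_of_tendsto (a := 0)
    (f := fun u => if 0 < u then -(1 / Real.Gamma p * u ^ p * Real.exp (-u) * F u) else 0)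
    (f' := fun u => (1 / Real.Gamma p * u ^ (p - 1) * Real.exp (-u)) •
      ((fun u => (u - p) * F u) - fun u => u * F' u) u) (m := 0) ?_ ?_ hi' ?_
  · simpa using key
  · rw [← continuousWithinAt_Ioi_iff_Ici, ContinuousWithinAt]
    simp only [lt_self_iff_false, if_false]
    refine squeeze_zero_norm' (a := fun u => C / Real.Gamma p * (u ^ p * Real.exp (-u))) ?_ ?_
    · filter_upwards [self_mem_nhdsWithin] with u hu
      rw [if_pos (mem_Ioi.1 hu), norm_neg]
      exact hbound u hu
    · have : ContinuousAt (fun u : ℝ => C / Real.Gamma p * (u ^ p * Real.exp (-u))) 0 := by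
        have := Real.continuousAt_rpow_const 0 p (Or.inr hp.le)
        fun_prop
      have h := this.tendsto
      simp only [Real.zero_rpow hp.ne', zero_mul, mul_zero] at h
      exact h.mono_left nhdsWithin_le_nhds
  · intro u hu
    have hu : 0 < u := hu
    have h1 : HasDerivAt (fun u => -(1 / Real.Gamma p * u ^ p * Real.exp (-u) * F u))
        (-((1 / Real.Gamma p * (p * u ^ (p - 1)) * Real.exp (-u) +
          1 / Real.Gamma p * u ^ p * (Real.exp (-u) * -1)) * F u +
            1 / Real.Gamma p * u ^ p * Real.exp (-u) * F' u)) u :=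
      (((((Real.hasDerivAt_rpow_const (Or.inl hu.ne')).const_mul _).mul
        (hasDerivAt_neg u).exp)).mul (hF u hu)).neg
    refine (h1.congr_of_eventuallyEq ?_).congr_deriv ?_
    · filter_upwards [Ioi_mem_nhds hu] with v hv
      rw [if_pos (mem_Ioi.1 hv)]
    · have : u ^ p = u ^ (p - 1) * u := by
        rw [← Real.rpow_add_one hu.ne']; ring_nf
      simp only [Pi.sub_apply, smul_eq_mul, this]
      ring
  · refine squeeze_zero_norm' (a := fun u => C / Real.Gamma p * (u ^ p * Real.exp (-u))) ?_ ?_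
    · filter_upwards [Ioi_mem_atTop 0] with u hu
      rw [if_pos (mem_Ioi.1 hu), norm_neg]
      exact hbound u hu
    · have h := tendsto_rpow_mul_exp_neg_mul_atTop_nhds_zero p 1 one_pos
      simpa using h.const_mul (C / Real.Gamma p)

theorem integral_id_gammaMeasure_one {p : ℝ} (hp : 0 < p) :
    ∫ u, u ∂gammaMeasure p 1 = p := by
  have := isProbabilityMeasure_gammaMeasure_one hp
  have h := integral_sub_mul_gammaMeasure_one hp (C := 1) (F := fun _ => 1) (F' := fun _ => 0)
    (fun u _ => hasDerivAt_const u 1) (by simp) (fun u hu => by simp; linarith)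
  simp only [mul_one, mul_zero, integral_zero] at h
  rw [integral_sub (integrable_id_gammaMeasure_one hp) (integrable_const p)] at h
  simp at h
  linarith

/-- Replacing one coordinate of a product probability measure by an independent copy preserves it. -/
theorem measurePreserving_update_pi {ι : Type*} [Fintype ι] [DecidableEq ι] {E : Type*}
    [MeasurableSpace E] (μ : ι → Measure E) [∀ k, IsProbabilityMeasure (μ k)] (k : ι) :
    MeasurePreserving (fun z : (ι → E) × E => Function.update z.1 k z.2)
      ((Measure.pi μ).prod (μ k)) (Measure.pi μ) := by
  refine ⟨measurable_update', ?_⟩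
  symm
  refine Measure.pi_eq fun s hs => ?_
  rw [Measure.map_apply measurable_update' (MeasurableSet.univ_pi hs)]
  have : (fun z : (ι → E) × E => Function.update z.1 k z.2) ⁻¹' (univ.pi s) =
      (univ.pi (Function.update s k univ)) ×ˢ s k := by
    ext z
    simp only [mem_preimage, mem_univ_pi, mem_prod]
    constructor
    · intro h
      refine ⟨fun l => ?_, by simpa using h k⟩
      by_cases hl : l = k
      · subst hl; simp
      · simpa [hl] using h l
    · rintro ⟨h1, h2⟩ l
      by_cases hl : l = k
      · subst hl; simpa using h2
      · simpa [hl] using h1 l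
  rw [this, Measure.prod_prod, Measure.pi_pi, ← Finset.mul_prod_erase _ _ (Finset.mem_univ k),
    ← Finset.mul_prod_erase Finset.univ (fun i => μ i (s i)) (Finset.mem_univ k), mul_comm]
  simp only [Function.update_self, measure_univ, one_mul]
  congr 1
  exact Finset.prod_congr rfl fun l hl => by rw [Function.update_of_ne (Finset.ne_of_mem_erase hl)]

/-! ### Products of gamma distributions -/

section Gamma

variable {ι : Type*} [Fintype ι]

/-- The product of gamma distributions with shapes `p k` and unit rate. -/
noncomputable abbrev gammaPi (p : ι → ℝ) : Measure (ι → ℝ) :=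
  Measure.pi fun k => gammaMeasure (p k) 1

variable {p : ι → ℝ} [hp : ∀ k, Fact (0 < p k)]

theorem gammaPi_ae_pos : ∀ᵐ u ∂gammaPi p, ∀ k, 0 < u k := by
  rw [ae_all_iff]
  intro k
  exact (measurePreserving_eval (fun k => gammaMeasure (p k) 1) k).quasiMeasurePreserving.ae
    (gammaMeasure_one_ae_pos (p k))

theorem memLp_eval_gammaPi (k : ι) : MemLp (fun u : ι → ℝ => u k) 2 (gammaPi p) :=
  (memLp_id_gammaMeasure_one (hp k).out).comp_measurePreserving
    (measurePreserving_eval (fun k => gammaMeasure (p k) 1) k)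

theorem integrable_eval_gammaPi (k : ι) : Integrable (fun u : ι → ℝ => u k) (gammaPi p) :=
  (memLp_eval_gammaPi k).integrable (by norm_num)

theorem integrable_eval_mul_eval_gammaPi (k l : ι) :
    Integrable (fun u : ι → ℝ => u k * u l) (gammaPi p) :=
  (memLp_eval_gammaPi k).integrable_mul (memLp_eval_gammaPi l)

theorem integral_eval_gammaPi (k : ι) : ∫ u, u k ∂gammaPi p = p k := by
  have h := measurePreserving_eval (fun k => gammaMeasure (p k) 1) k
  have h2 := integral_map (f := fun s : ℝ => s) h.aemeasurable (by fun_prop)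
  rw [h.map_eq] at h2
  rw [← integral_id_gammaMeasure_one (hp k).out, h2]

variable [DecidableEq ι]

/-- Resampling coordinate k gives Fubini in that coordinate without splitting the index type. -/
theorem integral_gammaPi_update (k : ι) {F : (ι → ℝ) → ℝ} (hF : Integrable F (gammaPi p)) :
    ∫ u, F u ∂gammaPi p =
      ∫ u, ∫ s, F (Function.update u k s) ∂gammaMeasure (p k) 1 ∂gammaPi p := by
  have h : MeasurePreserving _ _ (gammaPi p) :=
    measurePreserving_update_pi (fun k => gammaMeasure (p k) 1) k
  have hF' := hF
  rw [← h.map_eq] at hF'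
  have h2 := integral_prod _ ((integrable_map_measure hF'.1 h.aemeasurable).1 hF')
  simp only [Function.comp_apply] at h2
  rw [← h2, ← integral_map h.aemeasurable hF'.1, h.map_eq]

theorem lintegral_gammaPi_update (k : ι) {F : (ι → ℝ) → ENNReal} (hF : Measurable F) :
    ∫⁻ u, F u ∂gammaPi p =
      ∫⁻ u, ∫⁻ s, F (Function.update u k s) ∂gammaMeasure (p k) 1 ∂gammaPi p := by
  have h := measurePreserving_update_pi (fun k => gammaMeasure (p k) 1) k
  rw [← h.lintegral_comp hF, lintegral_prod _ (by
    exact (hF.comp h.measurable).aemeasurable)]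

/-- Integration by parts in one coordinate of a product of gamma distributions. -/
theorem integral_sub_mul_gammaPi (k : ι) {F F' : (ι → ℝ) → ℝ}
    (hFi : Integrable (fun u => (u k - p k) * F u) (gammaPi p))
    (hFi' : Integrable (fun u => u k * F' u) (gammaPi p))
    (h : ∀ u : ι → ℝ, (∀ l, 0 < u l) → ∃ C : ℝ, ∀ s, 0 < s →
      HasDerivAt (fun s => F (Function.update u k s)) (F' (Function.update u k s)) s ∧
      |F (Function.update u k s)| ≤ C ∧ |s * F' (Function.update u k s)| ≤ C * (1 + s)) :
    ∫ u, (u k - p k) * F u ∂gammaPi p = ∫ u, u k * F' u ∂gammaPi p := by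
  rw [integral_gammaPi_update k hFi, integral_gammaPi_update k hFi']
  refine integral_congr_ae ?_
  filter_upwards [gammaPi_ae_pos] with u hu
  obtain ⟨C, hC⟩ := h u hu
  simp only [Function.update_self]
  exact integral_sub_mul_gammaMeasure_one (hp k).out (fun s hs => (hC s hs).1)
    (fun s hs => (hC s hs).2.1) (fun s hs => (hC s hs).2.2)

end Gamma

/-! ### Smooth steps and the derivative of the smoothed tail -/

/-- A smooth decreasing step `φ` from `1` to `0` on `[0, 1]`, with `η = -φ'`. -/
structure SmoothStep where
  φ : ℝ → ℝ
  η : ℝ → ℝ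
  η' : ℝ → ℝ
  C : ℝ
  hasDerivAt_φ : ∀ y, HasDerivAt φ (-η y) y
  hasDerivAt_η : ∀ y, HasDerivAt η (η' y) y
  continuous_η' : Continuous η'
  abs_φ_le : ∀ y, |φ y| ≤ 1
  η_nonneg : ∀ y, 0 ≤ η y
  η_eq_zero : ∀ y, y ∉ Icc (0 : ℝ) 1 → η y = 0
  η_le : ∀ y, η y ≤ C
  abs_η'_le : ∀ y, |η' y| ≤ C

namespace SmoothStep

variable (f : SmoothStep)

theorem C_nonneg : 0 ≤ f.C := (abs_nonneg _).trans (f.abs_η'_le 0)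

theorem continuous_φ : Continuous f.φ :=
  continuous_iff_continuousAt.2 fun y => (f.hasDerivAt_φ y).continuousAt

theorem continuous_η : Continuous f.η :=
  continuous_iff_continuousAt.2 fun y => (f.hasDerivAt_η y).continuousAt

theorem abs_η_le (y : ℝ) : |f.η y| ≤ f.C := by
  rw [abs_of_nonneg (f.η_nonneg y)]; exact f.η_le y

end SmoothStep

theorem hasDerivAt_sum_mul_update {ι : Type*} [DecidableEq ι] (B : Finset ι) (lam u : ι → ℝ) (k : ι) (s : ℝ) :
    HasDerivAt (fun s => ∑ l ∈ B, lam l * Function.update u k s l)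
      (if k ∈ B then lam k else 0) s := by
  have h := HasDerivAt.fun_sum (u := B) fun l _ =>
    (hasDerivAt_pi.1 (hasDerivAt_update u k s) l).const_mul (lam l)
  refine h.congr_deriv ?_
  simp [Pi.single_apply]

section

variable {ι : Type*} [Fintype ι] {p : ι → ℝ} [hp : ∀ k, Fact (0 < p k)] (f : SmoothStep)

theorem integrable_φ_gammaPi (lam : ι → ℝ) (x : ℝ) :
    Integrable (fun u => f.φ (x - ∑ k, lam k * u k)) (gammaPi p) := by
  have := f.continuous_φ
  refine (integrable_const (1 : ℝ)).mono'
    (Continuous.aestronglyMeasurable (by fun_prop)) (ae_of_all _ fun u => f.abs_φ_le _)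

theorem hasDerivAt_integral_φ_gammaPi (lam v : ι → ℝ) (x t : ℝ) :
    HasDerivAt (fun t => ∫ u : ι → ℝ, f.φ (x - ∑ k, (lam k + t * v k) * u k) ∂gammaPi p)
      (∫ u : ι → ℝ, f.η (x - ∑ k, (lam k + t * v k) * u k) * ∑ k, v k * u k ∂gammaPi p) t := by
  have hφ := f.continuous_φ
  have hη := f.continuous_η
  refine (hasDerivAt_integral_of_dominated_loc_of_deriv_le (s := univ)
    (F := fun t (u : ι → ℝ) => f.φ (x - ∑ k, (lam k + t * v k) * u k))
    (F' := fun t (u : ι → ℝ) => f.η (x - ∑ k, (lam k + t * v k) * u k) * ∑ k, v k * u k)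
    (bound := fun u : ι → ℝ => f.C * ∑ k, |v k| * |u k|) univ_mem ?_ ?_ ?_ ?_ ?_ ?_).2
  · exact Eventually.of_forall fun t => Continuous.aestronglyMeasurable (by fun_prop)
  · exact integrable_φ_gammaPi f (fun k => lam k + t * v k) x
  · exact Continuous.aestronglyMeasurable (by fun_prop)
  · refine ae_of_all _ fun u t _ => ?_
    rw [norm_mul, Real.norm_eq_abs]
    refine mul_le_mul (f.abs_η_le _) ?_ (norm_nonneg _) f.C_nonneg
    refine (norm_sum_le _ _).trans_eq ?_
    simp
  · exact (integrable_finsetSum _ fun k _ =>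
      (integrable_eval_gammaPi k).abs.const_mul _).const_mul _
  · refine ae_of_all _ fun u t _ => ?_
    have h1 : HasDerivAt (fun t => x - ∑ k, (lam k + t * v k) * u k) (-∑ k, v k * u k) t := by
      refine HasDerivAt.const_sub _ (HasDerivAt.fun_sum fun k _ => ?_)
      simpa using (((hasDerivAt_id t).mul_const (v k)).const_add (lam k)).mul_const (u k)
    refine ((f.hasDerivAt_φ _).comp t h1).congr_deriv ?_
    ring

variable [DecidableEq ι]

/-- Integration by parts in u_i, where ∂_i η(x - S) = -λ_i η'(x - S). Exchanging i and j leaves the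
right-hand integral unchanged and only replaces λ_i by λ_j, so the difference of the two identities
carries the factor λ_i - λ_j. -/
theorem integral_pair_η_gammaPi {i j : ι} (hij : i ≠ j) (lam : ι → ℝ) (x : ℝ) :
    ∫ u, u j * (p i - u i) * f.η (x - ∑ k, lam k * u k) ∂gammaPi p =
      lam i * ∫ u, u i * u j * f.η' (x - ∑ k, lam k * u k) ∂gammaPi p := by
  have hη := f.continuous_η
  have hη' := f.continuous_η'
  have h := integral_sub_mul_gammaPi (p := p) i
    (F := fun u => u j * f.η (x - ∑ k, lam k * u k))
    (F' := fun u => u j * (-lam i * f.η' (x - ∑ k, lam k * u k))) ?_ ?_ ?_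
  · rw [← integral_const_mul, ← neg_inj, ← integral_neg, ← integral_neg]
    convert h using 1 <;> refine integral_congr_ae (ae_of_all _ fun u => ?_) <;> simp only <;> ring
  · have : Integrable (fun u : ι → ℝ => u i * u j - p i * u j) (gammaPi p) :=
      (integrable_eval_mul_eval_gammaPi i j).sub ((integrable_eval_gammaPi j).const_mul _)
    refine (this.mul_bdd (c := f.C) (g := fun u => f.η (x - ∑ k, lam k * u k))
      (Continuous.aestronglyMeasurable (by fun_prop)) (ae_of_all _ fun u => f.abs_η_le _)).congr (ae_of_all _ fun u => ?_)
    simp only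
    ring
  · refine (((integrable_eval_mul_eval_gammaPi i j).mul_const (-lam i)).mul_bdd (c := f.C)
      (g := fun u => f.η' (x - ∑ k, lam k * u k))
      (Continuous.aestronglyMeasurable (by fun_prop)) (ae_of_all _ fun u => f.abs_η'_le _)).congr (ae_of_all _ fun u => ?_)
    simp only
    ring
  · intro u hu
    have hC := f.C_nonneg
    refine ⟨u j * f.C * (1 + |lam i|), fun s hs => ⟨?_, ?_, ?_⟩⟩
    · simp only [Function.update_of_ne hij.symm]
      have h1 := (hasDerivAt_sum_mul_update Finset.univ lam u i s).const_sub x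
      refine (((f.hasDerivAt_η _).comp s h1).const_mul (u j)).congr_deriv ?_
      rw [if_pos (Finset.mem_univ i)]
      ring
    · simp only [Function.update_of_ne hij.symm, abs_mul, abs_of_pos (hu j)]
      calc _ ≤ u j * f.C := mul_le_mul_of_nonneg_left (f.abs_η_le _) (hu j).le
        _ ≤ _ := le_mul_of_one_le_right (mul_nonneg (hu j).le hC) (by linarith [abs_nonneg (lam i)])
    · simp only [Function.update_of_ne hij.symm, abs_mul, abs_of_pos (hu j), abs_of_pos hs, abs_neg]
      calc _ ≤ s * (u j * (|lam i| * f.C)) := by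
            gcongr
            · exact (hu j).le
            · exact f.abs_η'_le _
        _ ≤ _ := by
            have : 0 ≤ u j * f.C := mul_nonneg (hu j).le hC
            nlinarith [mul_nonneg this (abs_nonneg (lam i)), mul_nonneg this hs.le]

/-- Moving weight between two coordinates changes the smoothed tail at a rate governed by the
second derivative of the step. -/
theorem hasDerivAt_integral_φ_transfer {i j : ι} (hij : i ≠ j) (lam : ι → ℝ) (x t : ℝ) :
    HasDerivAt (fun t => ∫ u : ι → ℝ, f.φ (x - ∑ k, (lam k + t *
        (Pi.single i (1 / p i) - Pi.single j (1 / p j) : ι → ℝ) k) * u k) ∂gammaPi p)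
      (-((lam i + t / p i) - (lam j - t / p j)) / (p i * p j) *
        ∫ u, u i * u j * f.η' (x - ∑ k, (lam k + t *
        (Pi.single i (1 / p i) - Pi.single j (1 / p j) : ι → ℝ) k) * u k) ∂gammaPi p) t := by
  set v : ι → ℝ := Pi.single i (1 / p i) - Pi.single j (1 / p j) with hv
  refine (hasDerivAt_integral_φ_gammaPi f lam v x t).congr_deriv ?_
  have hη := f.continuous_η
  have hi := (hp i).out
  have hj := (hp j).out
  set lam' : ι → ℝ := fun k => lam k + t * v k with hlam'
  have hvi : v i = 1 / p i := by simp [hv, hij]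
  have hvj : v j = -(1 / p j) := by simp [hv, hij.symm]
  have e1 := integral_pair_η_gammaPi (p := p) f hij lam' x
  have e2 := integral_pair_η_gammaPi (p := p) f hij.symm lam' x
  have hint : ∀ i j : ι, Integrable (fun u => u j * (p i - u i) * f.η (x - ∑ k, lam' k * u k))
      (gammaPi p) := by
    intro i j
    have : Integrable (fun u : ι → ℝ => p i * u j - u j * u i) (gammaPi p) :=
      ((integrable_eval_gammaPi j).const_mul _).sub (integrable_eval_mul_eval_gammaPi j i)
    refine (this.mul_bdd (c := f.C) (g := fun u => f.η (x - ∑ k, lam' k * u k))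
      (Continuous.aestronglyMeasurable (by fun_prop)) (ae_of_all _ fun u => f.abs_η_le _)).congr (ae_of_all _ fun u => ?_)
    simp only
    ring
  have hsum : ∀ u : ι → ℝ, ∑ k, v k * u k = u i / p i - u j / p j := by
    intro u
    simp only [hv, Pi.sub_apply, sub_mul, Finset.sum_sub_distrib, Pi.single_apply, ite_mul, zero_mul,
      Finset.sum_ite_eq', Finset.mem_univ, if_true]
    ring
  have hswap : ∀ u : ι → ℝ, u j * u i = u i * u j := fun u => mul_comm _ _
  simp only [hswap] at e2
  have h3 : lam i + t / p i = lam' i := by simp [hlam', hvi]; ring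
  have h4 : lam j - t / p j = lam' j := by simp [hlam', hvj]; ring
  rw [h3, h4]
  -- A cancelling term u_i u_j is inserted so that both pieces have the shape of
  -- `integral_pair_η_gammaPi`.
  have : ∀ u : ι → ℝ, f.η (x - ∑ k, lam' k * u k) * ∑ k, v k * u k = 1 / (p i * p j) *
      (u i * (p j - u j) * f.η (x - ∑ k, lam' k * u k) -
        u j * (p i - u i) * f.η (x - ∑ k, lam' k * u k)) := by
    intro u
    rw [hsum]
    field_simp
    ring
  rw [integral_congr_ae (ae_of_all _ this), integral_const_mul, integral_sub (hint j i) (hint i j), e1, e2]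
  ring

end

/-! ### Radial integration by parts -/

section

variable {ι : Type*} [Fintype ι] [DecidableEq ι] {p : ι → ℝ} [hp : ∀ k, Fact (0 < p k)]
  (f : SmoothStep)

/-- The sum dominates its term λ_i u_i, which cancels the factor u_i. This controls the kernel
although its denominator can be arbitrarily small. -/
theorem mul_div_sum_le {B : Finset ι} {lam u : ι → ℝ} (hlam : ∀ k ∈ B, 0 < lam k)
    (hu : ∀ k, 0 < u k) {i : ι} (hi : i ∈ B) (y : ℝ) (hy : 0 ≤ y) :
    u i * y / ∑ k ∈ B, lam k * u k ≤ y / lam i := by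
  have h1 : lam i * u i ≤ ∑ k ∈ B, lam k * u k :=
    Finset.single_le_sum (f := fun k => lam k * u k)
      (fun k hk => (mul_pos (hlam k hk) (hu k)).le) hi
  have h2 := mul_pos (hlam i hi) (hu i)
  rw [div_le_div_iff₀ (h2.trans_le h1) (hlam i hi)]
  nlinarith [mul_le_mul_of_nonneg_left h1 hy]

theorem abs_mul_sub_le {a b c C D : ℝ} (ha : |a| ≤ C) (hb : |b| ≤ D) (hc : |c| ≤ C) :
    |a - b - c| ≤ 2 * C + D := by
  have h1 := abs_le.1 ha
  have h2 := abs_le.1 hb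
  have h3 := abs_le.1 hc
  rw [abs_le]
  constructor <;> linarith

/-- The density `u i * u j * η / L` used in the radial integration by parts. -/
noncomputable def radialKernel (B : Finset ι) (lam : ι → ℝ) (x : ℝ) (i j : ι) (u : ι → ℝ) : ℝ :=
  u i * u j * f.η (x - ∑ k, lam k * u k) / ∑ k ∈ B, lam k * u k

/-- The partial derivative of `radialKernel` in the direction `k`. -/
noncomputable def radialKernelDeriv (B : Finset ι) (lam : ι → ℝ) (x : ℝ) (i j k : ι) (u : ι → ℝ) :
    ℝ :=
  ((Pi.single k (1 : ℝ) : ι → ℝ) i * u j + u i * (Pi.single k (1 : ℝ) : ι → ℝ) j) *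
      f.η (x - ∑ k, lam k * u k) / (∑ k ∈ B, lam k * u k) -
    u i * u j * (f.η' (x - ∑ k, lam k * u k) * lam k) / (∑ k ∈ B, lam k * u k) -
    u i * u j * f.η (x - ∑ k, lam k * u k) * lam k / (∑ k ∈ B, lam k * u k) ^ 2

variable {f} {B : Finset ι} {lam : ι → ℝ} {x : ℝ} {i j : ι}

theorem sum_mul_pos (hlam : ∀ k ∈ B, 0 < lam k) (hi : i ∈ B) {u : ι → ℝ} (hu : ∀ k, 0 < u k) :
    0 < ∑ k ∈ B, lam k * u k :=
  Finset.sum_pos (fun k hk => mul_pos (hlam k hk) (hu k)) ⟨i, hi⟩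

theorem radialKernel_nonneg (hlam : ∀ k ∈ B, 0 < lam k) (hi : i ∈ B) {u : ι → ℝ}
    (hu : ∀ k, 0 < u k) : 0 ≤ radialKernel f B lam x i j u :=
  div_nonneg (mul_nonneg (mul_pos (hu i) (hu j)).le (f.η_nonneg _)) (sum_mul_pos hlam hi hu).le

theorem radialKernel_comm (u : ι → ℝ) :
    radialKernel f B lam x i j u = radialKernel f B lam x j i u := by
  simp only [radialKernel, mul_comm (u i)]

theorem abs_radialKernel_le (hlam : ∀ k ∈ B, 0 < lam k) (hi : i ∈ B) {u : ι → ℝ}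
    (hu : ∀ k, 0 < u k) : |radialKernel f B lam x i j u| ≤ f.C * u j / lam i := by
  rw [abs_of_nonneg (radialKernel_nonneg hlam hi hu), radialKernel, mul_assoc]
  refine (mul_div_sum_le hlam hu hi _ (mul_nonneg (hu j).le (f.η_nonneg _))).trans ?_
  rw [mul_comm f.C]
  have := hlam i hi
  have := hu j
  gcongr
  exact f.η_le _

theorem radialKernelDeriv_comm {k : ι} (u : ι → ℝ) :
    radialKernelDeriv f B lam x i j k u = radialKernelDeriv f B lam x j i k u := by
  simp only [radialKernelDeriv]
  ring

theorem abs_mul_radialKernelDeriv_le (hlam : ∀ k ∈ B, 0 < lam k) (hi : i ∈ B) (hij : i ≠ j)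
    {k : ι} (hk : k ∈ B) {u : ι → ℝ} (hu : ∀ k, 0 < u k) :
    |u k * radialKernelDeriv f B lam x i j k u| ≤ 2 * (f.C * u j / lam i) + f.C * (u i * u j) := by
  have hL := sum_mul_pos hlam hi hu
  have h0 := abs_radialKernel_le (f := f) (x := x) (j := j) hlam hi hu
  have hk1 : lam k * u k / (∑ k ∈ B, lam k * u k) ≤ 1 := by
    rw [div_le_one hL]
    exact Finset.single_le_sum (f := fun k => lam k * u k)
      (fun k hk => (mul_pos (hlam k hk) (hu k)).le) hk
  have hk0 : 0 ≤ lam k * u k / (∑ k ∈ B, lam k * u k) :=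
    div_nonneg (mul_pos (hlam k hk) (hu k)).le hL.le
  have hw := mul_pos (hu i) (hu j)
  -- Multiplication by u_k turns every singular factor into the ratio λ_k u_k / L, which lies in [0,
  -- 1].
  have e : u k * radialKernelDeriv f B lam x i j k u =
      (if k = i ∨ k = j then radialKernel f B lam x i j u else 0) -
      u i * u j * f.η' (x - ∑ k, lam k * u k) * (lam k * u k / (∑ k ∈ B, lam k * u k)) -
      radialKernel f B lam x i j u * (lam k * u k / (∑ k ∈ B, lam k * u k)) := by
    simp only [radialKernelDeriv, radialKernel, Pi.single_apply]
    by_cases h1 : i = k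
    · subst h1
      simp [hij.symm]
      field_simp
    · by_cases h2 : j = k
      · subst h2
        simp [hij]
        field_simp
      · simp [h1, h2, Ne.symm h1, Ne.symm h2]
        field_simp
  rw [e]
  refine abs_mul_sub_le ?_ ?_ ?_
  · split_ifs
    · exact h0
    · simpa using (abs_nonneg _).trans h0
  · rw [abs_mul, abs_mul, abs_of_pos hw, abs_of_nonneg hk0]
    calc _ ≤ u i * u j * f.C * 1 := by
          gcongr
          · exact mul_nonneg hw.le f.C_nonneg
          · exact f.abs_η'_le _
      _ = _ := by ring
  · rw [abs_mul, abs_of_nonneg hk0]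
    calc _ ≤ (f.C * u j / lam i) * 1 := by
          gcongr
          exact (abs_nonneg _).trans h0
      _ = _ := by ring

theorem hasDerivAt_radialKernel (hlam : ∀ k ∈ B, 0 < lam k) (hi : i ∈ B) {k : ι} (hk : k ∈ B)
    {u : ι → ℝ} (hu : ∀ k, 0 < u k) {s : ℝ} (hs : 0 < s) :
    HasDerivAt (fun s => radialKernel f B lam x i j (Function.update u k s))
      (radialKernelDeriv f B lam x i j k (Function.update u k s)) s := by
  have hu' : ∀ l, 0 < Function.update u k s l := by
    intro l
    by_cases h : l = k
    · subst h; simpa using hs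
    · simpa [h] using hu l
  have hL := sum_mul_pos hlam hi hu'
  have hc := hasDerivAt_pi.1 (hasDerivAt_update u k s)
  have h1 := (f.hasDerivAt_η _).comp s
    ((hasDerivAt_sum_mul_update Finset.univ lam u k s).const_sub x)
  have h2 := hasDerivAt_sum_mul_update B lam u k s
  refine ((((hc i).mul (hc j)).mul h1).div h2 hL.ne').congr_deriv ?_
  simp only [radialKernelDeriv, Function.comp_apply, Finset.mem_univ, if_true, hk]
  field_simp
  simp only [Pi.mul_apply, Function.comp_apply]
  ring

/-- Euler's identity: u_i u_j / L is homogeneous of degree 1 in the coordinates of B, and the radial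
derivative of η(x - S) is -L η'. The kernel is divided by L precisely so that this L cancels. -/
theorem sum_mul_radialKernelDeriv (hlam : ∀ k ∈ B, 0 < lam k) (hi : i ∈ B) (hj : j ∈ B)
    {u : ι → ℝ} (hu : ∀ k, 0 < u k) :
    ∑ k ∈ B, u k * radialKernelDeriv f B lam x i j k u =
      radialKernel f B lam x i j u - u i * u j * f.η' (x - ∑ k, lam k * u k) := by
  have hL := sum_mul_pos hlam hi hu
  set L := ∑ k ∈ B, lam k * u k with hLdef
  set e := f.η (x - ∑ k, lam k * u k)
  set e' := f.η' (x - ∑ k, lam k * u k)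
  have h1 : ∀ k, u k * radialKernelDeriv f B lam x i j k u =
      (if i = k then u k * u j * e / L else 0) + (if j = k then u i * u k * e / L else 0) -
        u i * u j * e' / L * (lam k * u k) - u i * u j * e / L ^ 2 * (lam k * u k) := by
    intro k
    simp only [radialKernelDeriv, Pi.single_apply]
    split_ifs <;> ring
  simp only [h1, Finset.sum_sub_distrib, Finset.sum_add_distrib, Finset.sum_ite_eq, hi, hj, if_true,
    ← Finset.mul_sum, ← hLdef, radialKernel]
  field_simp
  ring

theorem measurable_radialKernel : Measurable (radialKernel f B lam x i j) := by
  have := f.continuous_η.measurable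
  unfold radialKernel
  fun_prop

theorem measurable_radialKernelDeriv {k : ι} : Measurable (radialKernelDeriv f B lam x i j k) := by
  have := f.continuous_η.measurable
  have := f.continuous_η'.measurable
  unfold radialKernelDeriv
  fun_prop

theorem integrable_mul_radialKernel (hlam : ∀ k ∈ B, 0 < lam k) (hi : i ∈ B) (k : ι) :
    Integrable (fun u => u k * radialKernel f B lam x i j u) (gammaPi p) := by
  refine ((integrable_eval_mul_eval_gammaPi k j).const_mul (f.C / lam i)).mono'
    ((measurable_pi_apply k).mul measurable_radialKernel).aestronglyMeasurable ?_
  filter_upwards [gammaPi_ae_pos] with u hu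
  rw [norm_mul, Real.norm_eq_abs, Real.norm_eq_abs, abs_of_pos (hu k)]
  calc _ ≤ u k * (f.C * u j / lam i) :=
        mul_le_mul_of_nonneg_left (abs_radialKernel_le hlam hi hu) (hu k).le
    _ = _ := by ring

theorem integrable_radialKernel (hlam : ∀ k ∈ B, 0 < lam k) (hi : i ∈ B) :
    Integrable (radialKernel f B lam x i j) (gammaPi p) := by
  refine ((integrable_eval_gammaPi j).const_mul (f.C / lam i)).mono'
    measurable_radialKernel.aestronglyMeasurable ?_
  filter_upwards [gammaPi_ae_pos] with u hu
  refine (abs_radialKernel_le hlam hi hu).trans_eq (by ring)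

theorem integrable_sub_mul_radialKernel (hlam : ∀ k ∈ B, 0 < lam k) (hi : i ∈ B) (k : ι) :
    Integrable (fun u => (u k - p k) * radialKernel f B lam x i j u) (gammaPi p) := by
  have h1 := integrable_mul_radialKernel (p := p) (f := f) (x := x) (j := j) hlam hi k
  have h2 := integrable_radialKernel (p := p) (f := f) (x := x) (j := j) hlam hi
  refine (h1.sub (h2.const_mul (p k))).congr (ae_of_all _ fun u => ?_)
  simp only [Pi.sub_apply]
  ring

theorem integrable_mul_radialKernelDeriv (hlam : ∀ k ∈ B, 0 < lam k) (hi : i ∈ B) (hij : i ≠ j)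
    {k : ι} (hk : k ∈ B) :
    Integrable (fun u => u k * radialKernelDeriv f B lam x i j k u) (gammaPi p) := by
  refine (((integrable_eval_gammaPi j).const_mul (2 * f.C / lam i)).add
    ((integrable_eval_mul_eval_gammaPi i j).const_mul f.C)).mono'
    ((measurable_pi_apply k).mul measurable_radialKernelDeriv).aestronglyMeasurable ?_
  filter_upwards [gammaPi_ae_pos] with u hu
  refine (abs_mul_radialKernelDeriv_le hlam hi hij hk hu).trans_eq ?_
  simp only [Pi.add_apply]
  ring

theorem integral_sub_mul_radialKernel (hlam : ∀ k ∈ B, 0 < lam k) (hi : i ∈ B) (hj : j ∈ B)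
    (hij : i ≠ j) {k : ι} (hk : k ∈ B) :
    ∫ u, (u k - p k) * radialKernel f B lam x i j u ∂gammaPi p =
      ∫ u, u k * radialKernelDeriv f B lam x i j k u ∂gammaPi p := by
  -- The kernel is symmetric in i and j, and at most one of them equals k. With j ≠ k, the bound C
  -- u_j / λ_i does not change when u_k varies.
  wlog hjk : j ≠ k generalizing i j
  · have hik : i ≠ k := by
      rintro rfl
      exact hjk hij.symm
    have := this hj hi hij.symm hik
    simpa only [radialKernel_comm (i := j), radialKernelDeriv_comm (i := j)] using this
  refine integral_sub_mul_gammaPi k ?_ (integrable_mul_radialKernelDeriv hlam hi hij hk) ?_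
  · exact integrable_sub_mul_radialKernel hlam hi k
  · intro u hu
    have hC := f.C_nonneg
    have hj' := hu j
    have hi' := hu i
    have hl := hlam i hi
    refine ⟨2 * (f.C * u j / lam i) + f.C * ((1 + u i) * u j), fun s hs => ?_⟩
    have hu' : ∀ l, 0 < Function.update u k s l := by
      intro l
      by_cases h : l = k
      · subst h; simpa using hs
      · simpa [h] using hu l
    have hD : 0 ≤ f.C * u j / lam i := by positivity
    have hE : 0 ≤ f.C * ((1 + u i) * u j) := by positivity
    refine ⟨hasDerivAt_radialKernel hlam hi hk hu hs, ?_, ?_⟩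
    · refine (abs_radialKernel_le hlam hi hu').trans ?_
      rw [Function.update_of_ne hjk]
      linarith
    · have := abs_mul_radialKernelDeriv_le (f := f) (x := x) hlam hi hij hk hu'
      rw [Function.update_self, Function.update_of_ne hjk] at this
      refine this.trans ?_
      have h3 : Function.update u k s i ≤ (1 + u i) * (1 + s) := by
        by_cases h : i = k
        · subst h
          rw [Function.update_self]
          nlinarith
        · rw [Function.update_of_ne h]
          nlinarith
      have h4 : f.C * (Function.update u k s i * u j) ≤ f.C * ((1 + u i) * u j) * (1 + s) := by
        calc _ ≤ f.C * ((1 + u i) * (1 + s) * u j) := by gcongr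
          _ = _ := by ring
      nlinarith

/-- Radial integration by parts over the coordinates in `B`. -/
theorem integral_weight_mul_η' (hlam : ∀ k ∈ B, 0 < lam k) (hi : i ∈ B) (hj : j ∈ B)
    (hij : i ≠ j) :
    ∫ u, u i * u j * f.η' (x - ∑ k, lam k * u k) ∂gammaPi p =
      -∫ u, radialKernel f B lam x i j u * (∑ k ∈ B, u k - (∑ k ∈ B, p k + 1)) ∂gammaPi p := by
  have hη' := f.continuous_η'
  have hK := integrable_radialKernel (p := p) (f := f) (x := x) (j := j) hlam hi
  have hKsub := integrable_sub_mul_radialKernel (p := p) (f := f) (x := x) (j := j) hlam hi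
  have hw : Integrable (fun u : ι → ℝ => u i * u j * f.η' (x - ∑ k, lam k * u k)) (gammaPi p) :=
    (integrable_eval_mul_eval_gammaPi i j).mul_bdd (c := f.C)
      (Continuous.aestronglyMeasurable (by fun_prop)) (ae_of_all _ fun u => f.abs_η'_le _)
  have h1 : ∑ k ∈ B, ∫ u, (u k - p k) * radialKernel f B lam x i j u ∂gammaPi p =
      ∑ k ∈ B, ∫ u, u k * radialKernelDeriv f B lam x i j k u ∂gammaPi p :=
    Finset.sum_congr rfl fun k hk => integral_sub_mul_radialKernel hlam hi hj hij hk
  rw [← integral_finsetSum _ fun k _ => hKsub k,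
    ← integral_finsetSum _ fun k hk => integrable_mul_radialKernelDeriv hlam hi hij hk] at h1
  have h2 : ∫ u, ∑ k ∈ B, u k * radialKernelDeriv f B lam x i j k u ∂gammaPi p =
      ∫ u, radialKernel f B lam x i j u ∂gammaPi p -
        ∫ u, u i * u j * f.η' (x - ∑ k, lam k * u k) ∂gammaPi p := by
    rw [← integral_sub hK hw]
    refine integral_congr_ae ?_
    filter_upwards [gammaPi_ae_pos] with u hu
    exact sum_mul_radialKernelDeriv hlam hi hj hu
  rw [h2] at h1
  -- The `+ 1` is the degree of homogeneity in Euler's identity.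
  have h3 : ∀ u : ι → ℝ, radialKernel f B lam x i j u * (∑ k ∈ B, u k - (∑ k ∈ B, p k + 1)) =
      ∑ k ∈ B, (u k - p k) * radialKernel f B lam x i j u - radialKernel f B lam x i j u := by
    intro u
    rw [← Finset.sum_mul, Finset.sum_sub_distrib]
    ring
  simp only [h3]
  rw [integral_sub (integrable_finsetSum _ fun k _ => hKsub k) hK, h1]
  ring

end

/-! ### Monotonicity of the smoothed tail along a transfer -/

section

variable {ι : Type*} [Fintype ι] [DecidableEq ι] {p : ι → ℝ} [hp : ∀ k, Fact (0 < p k)]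
  (f : SmoothStep)

/-- The path moving weight from coordinate `j` to coordinate `i` at constant mean. -/
noncomputable def transferPath (p lam : ι → ℝ) (i j : ι) (t : ℝ) : ι → ℝ := fun k =>
  lam k + t * (Pi.single i (1 / p i) - Pi.single j (1 / p j) : ι → ℝ) k

theorem transferPath_zero (p lam : ι → ℝ) (i j : ι) : transferPath p lam i j 0 = lam := by
  funext k
  simp [transferPath]

theorem transferPath_left (p lam : ι → ℝ) {i j : ι} (hij : i ≠ j) (t : ℝ) :
    transferPath p lam i j t i = lam i + t / p i := by
  simp [transferPath, hij]
  ring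

theorem transferPath_right (p lam : ι → ℝ) {i j : ι} (hij : i ≠ j) (t : ℝ) :
    transferPath p lam i j t j = lam j - t / p j := by
  simp [transferPath, hij.symm]
  ring

theorem transferPath_of_ne (p lam : ι → ℝ) {i j k : ι} (hi : k ≠ i) (hj : k ≠ j) (t : ℝ) :
    transferPath p lam i j t k = lam k := by
  simp [transferPath, hi, hj]

/-- The derivative at t is the gap between the moved weights, which only widens, times the radial
integral, over p_i p_j. The set B may depend on t, and only interior times matter, so a weight may
vanish at time T. -/
theorem integral_φ_le_of_transfer {i j : ι} (hij : i ≠ j) (lam : ι → ℝ) (x : ℝ) {T : ℝ}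
    (hT : 0 ≤ T) (hle : lam j ≤ lam i)
    (h : ∀ t ∈ Ioo 0 T, ∃ B : Finset ι, i ∈ B ∧ j ∈ B ∧
      (∀ k ∈ B, 0 < transferPath p lam i j t k) ∧
      0 ≤ ∫ u, radialKernel f B (transferPath p lam i j t) x i j u *
        (∑ k ∈ B, u k - (∑ k ∈ B, p k + 1)) ∂gammaPi p) :
    ∫ u, f.φ (x - ∑ k, lam k * u k) ∂gammaPi p ≤
      ∫ u, f.φ (x - ∑ k, transferPath p lam i j T k * u k) ∂gammaPi p := by
  have hd := hasDerivAt_integral_φ_transfer (p := p) f hij lam x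
  have hmono : MonotoneOn (fun t => ∫ u : ι → ℝ, f.φ (x - ∑ k, transferPath p lam i j t k * u k)
      ∂gammaPi p) (Icc 0 T) := by
    refine monotoneOn_of_deriv_nonneg (convex_Icc 0 T)
      (fun t _ => (hd t).continuousAt.continuousWithinAt)
      (fun t _ => (hd t).differentiableAt.differentiableWithinAt) fun t ht => ?_
    rw [interior_Icc] at ht
    refine (hd t).deriv.symm ▸ ?_
    obtain ⟨B, hi, hj, hB, hpos⟩ := h t ht
    have e := integral_weight_mul_η' (p := p) (f := f) (x := x) hB hi hj hij
    simp only [transferPath] at e hpos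
    rw [e, neg_div, neg_mul_neg]
    refine mul_nonneg (div_nonneg ?_ (mul_pos (hp i).out (hp j).out).le) hpos
    have h1 := div_pos ht.1 (hp i).out
    have h2 := div_pos ht.1 (hp j).out
    linarith
  have := hmono (left_mem_Icc.2 hT) (right_mem_Icc.2 hT) hT
  simpa only [transferPath_zero] using this

/-- On the support of the kernel x - 1 ≤ S, and S ≤ ∑ u_k because the weights are at most 1, so the
second factor is nonnegative pointwise. The threshold depends on the number of coordinates, hence
the finer argument below. -/
theorem integral_radialKernel_univ_nonneg {lam : ι → ℝ} (hlam : ∀ k, 0 < lam k)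
    (hlam1 : ∀ k, lam k ≤ 1) {x : ℝ} (hx : ∑ k, p k + 2 ≤ x) (i j : ι) :
    0 ≤ ∫ u, radialKernel f Finset.univ lam x i j u *
        (∑ k, u k - (∑ k, p k + 1)) ∂gammaPi p := by
  refine integral_nonneg_of_ae ?_
  filter_upwards [gammaPi_ae_pos] with u hu
  have hK := radialKernel_nonneg (f := f) (x := x) (j := j) (B := Finset.univ) (i := i)
    (fun k _ => hlam k) (Finset.mem_univ i) hu
  by_cases h : x - ∑ k, lam k * u k ∈ Icc (0 : ℝ) 1
  · refine mul_nonneg hK ?_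
    have : ∑ k, lam k * u k ≤ ∑ k, u k := Finset.sum_le_sum fun k _ => by
      nlinarith [hlam1 k, hu k]
    linarith [h.2]
  · simp [radialKernel, f.η_eq_zero _ h]

end

/-! ### The kernel where the weighted sum over B is small -/

namespace SmoothStep

variable (f : SmoothStep)

/-- The total mass of `η`. -/
noncomputable def mass : ENNReal := ∫⁻ y, ENNReal.ofReal (f.η y)

theorem lintegral_η_sub (z : ℝ) : ∫⁻ y, ENNReal.ofReal (f.η (z - y)) = f.mass :=
  lintegral_sub_left_eq_self (fun y => ENNReal.ofReal (f.η y)) z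

end SmoothStep

/-- A bound for the kernel in two gamma variables, uniform in the position of the step. -/
theorem lintegral_two_gamma_le (f : SmoothStep) {α : ℝ} (hα : 1 / 2 ≤ α) {a : ℝ} (ha : 0 < a)
    {r : ℝ} (hr : 0 < r) (z : ℝ) :
    ∫⁻ s, ∫⁻ v, (if s + a * v < r then ENNReal.ofReal (v * f.η (z - (s + a * v)) / (s + a * v))
      else 0) ∂gammaMeasure α 1 ∂gammaMeasure α 1 ≤
    ENNReal.ofReal (r ^ (2 * α - 1) / (α * Real.Gamma α ^ 2) * a ^ (-(α + 1))) * f.mass := by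
  have hα0 : 0 < α := by linarith
  have hΓ := Real.Gamma_pos_of_pos hα0
  have hη := f.continuous_η.measurable
  -- The inner variable becomes w = s + a v, and v^α is replaced by its upper bound (w/a)^α. Thus s
  -- enters only through s < w, and η only through w.
  set G : ℝ → ℝ → ENNReal := fun s w => if s < w ∧ w < r then
    ENNReal.ofReal ((w / a) ^ α * f.η (z - w) / w) else 0 with hG
  have hGm : Measurable (Function.uncurry G) := by
    refine Measurable.ite ?_ ?_ measurable_const
    · exact (measurableSet_lt measurable_fst measurable_snd).inter
        (measurableSet_lt measurable_snd measurable_const)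
    · fun_prop
  have hGs : ∀ s, Measurable (G s) := fun s => hGm.comp measurable_prodMk_left
  have inner : ∀ s, 0 < s → ∫⁻ v, (if s + a * v < r then
      ENNReal.ofReal (v * f.η (z - (s + a * v)) / (s + a * v)) else 0) ∂gammaMeasure α 1 ≤
      ENNReal.ofReal (1 / Real.Gamma α * a⁻¹) * ∫⁻ w, G s w := by
    intro s hs
    have hm : Measurable fun v : ℝ => (if s + a * v < r then
      ENNReal.ofReal (v * f.η (z - (s + a * v)) / (s + a * v)) else 0) :=
      Measurable.ite (measurableSet_lt (by fun_prop) measurable_const) (by fun_prop)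
        measurable_const
    rw [lintegral_gammaMeasure_one _ hm]
    calc _ ≤ ∫⁻ v in Ioi 0, ENNReal.ofReal (1 / Real.Gamma α) * G s (a * v + s) := by
          refine setLIntegral_mono (((hGs s).comp (by fun_prop)).const_mul _) fun v hv => ?_
          have hv : 0 < v := hv
          have hav := mul_pos ha hv
          by_cases h : s + a * v < r
          · simp only [hG]
            rw [if_pos h, if_pos (by constructor <;> linarith),
              ← ENNReal.ofReal_mul (gammaDensity_nonneg hα0 hv), ← ENNReal.ofReal_mul (by positivity)]
            refine ENNReal.ofReal_le_ofReal ?_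
            have e1 : v ^ (α - 1) * v = v ^ α := by
              rw [← Real.rpow_add_one hv.ne']; ring_nf
            have e2 : v ^ α ≤ ((a * v + s) / a) ^ α := by
              refine Real.rpow_le_rpow hv.le ?_ hα0.le
              rw [le_div_iff₀ ha]; linarith
            have e3 : Real.exp (-v) ≤ 1 := Real.exp_le_one_iff.2 (by linarith)
            have e4 := f.η_nonneg (z - (a * v + s))
            rw [add_comm s]
            calc _ = 1 / Real.Gamma α * ((v ^ (α - 1) * v) * Real.exp (-v) *
                  f.η (z - (a * v + s)) / (a * v + s)) := by ring
              _ ≤ 1 / Real.Gamma α * (((a * v + s) / a) ^ α * 1 *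
                  f.η (z - (a * v + s)) / (a * v + s)) := by rw [e1]; gcongr
              _ = _ := by ring
          · rw [if_neg h, mul_zero]; exact zero_le
      _ ≤ ∫⁻ v, ENNReal.ofReal (1 / Real.Gamma α) * G s (a * v + s) := setLIntegral_le_lintegral _ _
      _ = ENNReal.ofReal (1 / Real.Gamma α) * (ENNReal.ofReal a⁻¹ * ∫⁻ w, G s w) := by
          rw [lintegral_const_mul _ (show Measurable fun v => G s (a * v + s) from
            (hGs s).comp (by fun_prop))]
          congr 1
          have h1 : ∫⁻ v, G s (a * v + s) = ∫⁻ y, G s (y + s) ∂(volume.map (a * ·)) := by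
            rw [lintegral_map (show Measurable fun y => G s (y + s) from
              (hGs s).comp (by fun_prop)) (by fun_prop)]
          rw [h1, Real.map_volume_mul_left ha.ne', lintegral_smul_measure,
            lintegral_add_right_eq_self (G s), abs_of_pos (inv_pos.2 ha), smul_eq_mul]
      _ = _ := by rw [← mul_assoc, ← ENNReal.ofReal_mul (by positivity)]
  have inner2 : ∀ w, ∫⁻ s in Ioi 0,
      ENNReal.ofReal (1 / Real.Gamma α * s ^ (α - 1) * Real.exp (-s)) * G s w ≤
      ENNReal.ofReal (r ^ (2 * α - 1) / (α * Real.Gamma α) * a ^ (-α)) *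
        ENNReal.ofReal (f.η (z - w)) := by
    intro w
    have e4 := f.η_nonneg (z - w)
    by_cases hw : 0 < w ∧ w < r
    swap
    · have : ∀ s ∈ Ioi (0 : ℝ),
          ENNReal.ofReal (1 / Real.Gamma α * s ^ (α - 1) * Real.exp (-s)) * G s w = 0 := by
        intro s hs
        have hs : 0 < s := hs
        rw [hG]
        simp only
        rw [if_neg (fun h => hw ⟨hs.trans h.1, h.2⟩), mul_zero]
      rw [setLIntegral_congr_fun measurableSet_Ioi this]
      simp
    obtain ⟨hw, hwr⟩ := hw
    have hbeta : ∫⁻ s in Ioc 0 w, ENNReal.ofReal (s ^ (α - 1)) = ENNReal.ofReal (w ^ α / α) := by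
      have h1 : IntegrableOn (fun s : ℝ => s ^ (α - 1)) (Ioc 0 w) :=
        (intervalIntegral.intervalIntegrable_rpow' (by linarith)).1
      rw [← ofReal_integral_eq_lintegral_ofReal h1]
      · rw [← intervalIntegral.integral_of_le hw.le, integral_rpow (Or.inl (by linarith))]
        simp [Real.zero_rpow hα0.ne']
      · filter_upwards [ae_restrict_mem measurableSet_Ioc] with s hs
        exact Real.rpow_nonneg hs.1.le _
    calc _ ≤ ∫⁻ s in Ioi 0, (Ioc 0 w).indicator (fun s => ENNReal.ofReal
          (1 / Real.Gamma α * ((w / a) ^ α * f.η (z - w) / w)) * ENNReal.ofReal (s ^ (α - 1))) s := by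
          refine setLIntegral_mono (Measurable.indicator (by fun_prop) measurableSet_Ioc)
            fun s hs => ?_
          have hs : 0 < s := hs
          simp only [hG]
          split_ifs with h
          · rw [indicator_of_mem (show s ∈ Ioc 0 w from ⟨hs, h.1.le⟩),
              ← ENNReal.ofReal_mul (gammaDensity_nonneg hα0 hs), ← ENNReal.ofReal_mul (by positivity)]
            refine ENNReal.ofReal_le_ofReal ?_
            have e3 : Real.exp (-s) ≤ 1 := Real.exp_le_one_iff.2 (by linarith)
            calc _ ≤ 1 / Real.Gamma α * s ^ (α - 1) * 1 * ((w / a) ^ α * f.η (z - w) / w) := by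
                  gcongr
              _ = _ := by ring
          · rw [mul_zero]; exact zero_le
      _ ≤ ∫⁻ s, (Ioc 0 w).indicator (fun s => ENNReal.ofReal
          (1 / Real.Gamma α * ((w / a) ^ α * f.η (z - w) / w)) * ENNReal.ofReal (s ^ (α - 1))) s :=
          setLIntegral_le_lintegral _ _
      _ = ENNReal.ofReal (1 / Real.Gamma α * ((w / a) ^ α * f.η (z - w) / w)) *
          ENNReal.ofReal (w ^ α / α) := by
          rw [lintegral_indicator measurableSet_Ioc, lintegral_const_mul _ (by fun_prop), hbeta]
      _ ≤ _ := by
          rw [← ENNReal.ofReal_mul (by positivity), ← ENNReal.ofReal_mul (by positivity)]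
          refine ENNReal.ofReal_le_ofReal ?_
          -- The two gamma densities contribute w^α each and the kernel 1/w; the resulting power is
          -- bounded near 0 because α ≥ 1/2.
          have h2 : w ^ (2 * α - 1) ≤ r ^ (2 * α - 1) :=
            Real.rpow_le_rpow hw.le hwr.le (by linarith)
          have h3 : w ^ (2 * α - 1) = w ^ α * w ^ α / w := by
            rw [Real.rpow_sub_one hw.ne', two_mul, Real.rpow_add hw]
          rw [Real.div_rpow hw.le ha.le, Real.rpow_neg ha.le]
          calc _ = w ^ (2 * α - 1) / (α * Real.Gamma α) * (a ^ α)⁻¹ * f.η (z - w) := by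
                rw [h3]; field_simp
            _ ≤ _ := by gcongr
  have hm2 : Measurable fun s => ∫⁻ w, G s w := hGm.lintegral_prod_right'
  calc _ ≤ ∫⁻ s, ENNReal.ofReal (1 / Real.Gamma α * a⁻¹) * (∫⁻ w, G s w) ∂gammaMeasure α 1 := by
        refine lintegral_mono_ae ?_
        filter_upwards [gammaMeasure_one_ae_pos α] with s hs using inner s hs
    _ = ENNReal.ofReal (1 / Real.Gamma α * a⁻¹) * ∫⁻ s in Ioi 0, ∫⁻ w,
        ENNReal.ofReal (1 / Real.Gamma α * s ^ (α - 1) * Real.exp (-s)) * G s w := by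
        rw [lintegral_const_mul _ hm2, lintegral_gammaMeasure_one _ hm2]
        congr 1
        refine lintegral_congr fun s => ?_
        rw [lintegral_const_mul _ (hGs s)]
    _ = ENNReal.ofReal (1 / Real.Gamma α * a⁻¹) * ∫⁻ w, ∫⁻ s in Ioi 0,
        ENNReal.ofReal (1 / Real.Gamma α * s ^ (α - 1) * Real.exp (-s)) * G s w := by
        rw [lintegral_lintegral_swap]
        exact (Measurable.mul (by fun_prop) hGm).aemeasurable
    _ ≤ ENNReal.ofReal (1 / Real.Gamma α * a⁻¹) * ∫⁻ w,
        ENNReal.ofReal (r ^ (2 * α - 1) / (α * Real.Gamma α) * a ^ (-α)) *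
          ENNReal.ofReal (f.η (z - w)) := by
        gcongr with w
        exact inner2 w
    _ = _ := by
        rw [lintegral_const_mul _ (by fun_prop), f.lintegral_η_sub, ← mul_assoc,
          ← ENNReal.ofReal_mul (by positivity)]
        congr 2
        -- The exponent -(α + 1) combines a^(-α) from (w/a)^α with a⁻¹ from the change of variables.
        rw [neg_add, Real.rpow_add ha, Real.rpow_neg_one]
        field_simp

section

variable {ι : Type*} [Fintype ι] [DecidableEq ι] {α : ℝ} [hα : Fact (0 < α)]

theorem sum_mul_update (B : Finset ι) (lam u : ι → ℝ) {k : ι} (hk : k ∈ B) (s : ℝ) :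
    ∑ l ∈ B, lam l * Function.update u k s l = ∑ l ∈ B, lam l * u l + lam k * (s - u k) := by
  rw [← Finset.add_sum_erase _ _ hk, ← Finset.add_sum_erase _ (fun l => lam l * u l) hk,
    Function.update_self, Finset.sum_congr rfl fun l hl => by
      rw [Function.update_of_ne (Finset.ne_of_mem_erase hl)]]
  ring

theorem sum_mul_update_of_notMem (B : Finset ι) (lam u : ι → ℝ) {k : ι} (hk : k ∉ B) (s : ℝ) :
    ∑ l ∈ B, lam l * Function.update u k s l = ∑ l ∈ B, lam l * u l :=
  Finset.sum_congr rfl fun l hl => by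
    rw [Function.update_of_ne (ne_of_mem_of_not_mem hl hk)]

/-- An exponential moment bound for a weighted sum of gamma variables. -/
theorem lintegral_exp_sum_mul_le {B : Finset ι} {j : ι} (hj : j ∈ B) {lam : ι → ℝ} {θ : ℝ}
    (hlam : ∀ k ∉ B, 0 ≤ θ * lam k ∧ θ * lam k ≤ 1 / 2) :
    ∫⁻ u, ENNReal.ofReal (Real.exp (θ * ∑ k ∈ Bᶜ, lam k * u k) * u j)
      ∂gammaPi (fun _ : ι => α) ≤ ENNReal.ofReal (α * Real.exp (2 * θ * α * ∑ k ∈ Bᶜ, lam k)) := by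
  have hα0 := hα.out
  -- The integrand factorises over the coordinates: u_j contributes its mean α, the rest of B
  -- contributes 1, and the complement contributes moment generating functions.
  set g : ι → ℝ → ℝ := fun k s =>
    if k ∈ B then (if k = j then s else 1) else Real.exp (θ * lam k * s) with hg
  have hgi : ∀ k, Integrable (g k) (gammaMeasure α 1) := by
    intro k
    simp only [hg]
    split_ifs with h1 h2
    · exact integrable_id_gammaMeasure_one hα0
    · exact integrable_const _
    · exact integrable_exp_mul_gammaMeasure_one hα0 (by linarith [(hlam k h1).2])
  have hprod : ∀ u : ι → ℝ, Real.exp (θ * ∑ k ∈ Bᶜ, lam k * u k) * u j = ∏ k, g k (u k) := by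
    intro u
    rw [← Finset.prod_mul_prod_compl B, mul_comm]
    congr 1
    · rw [Finset.prod_congr rfl (g := fun k => if k = j then u k else 1)
        fun k hk => by simp only [hg, hk, if_true], Finset.prod_ite_eq' B j, if_pos hj]
    · rw [Finset.mul_sum, Real.exp_sum]
      refine Finset.prod_congr rfl fun k hk => ?_
      simp only [hg, if_neg (Finset.mem_compl.1 hk), mul_assoc]
  have hi : Integrable (fun u : ι → ℝ => ∏ k, g k (u k)) (gammaPi fun _ : ι => α) :=
    Integrable.fintype_prod hgi
  simp only [hprod]
  rw [← ofReal_integral_eq_lintegral_ofReal hi]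
  · refine ENNReal.ofReal_le_ofReal ?_
    rw [integral_fintype_prod_eq_prod]
    rw [← Finset.prod_mul_prod_compl B]
    refine mul_le_mul ?_ ?_ ?_ hα0.le
    · have : ∀ k ∈ B, ∫ s, g k s ∂gammaMeasure α 1 = if k = j then α else 1 := by
        intro k hk
        simp only [hg, hk, if_true]
        split_ifs
        · exact integral_id_gammaMeasure_one hα0
        · simp
      rw [Finset.prod_congr rfl this, Finset.prod_ite_eq' B j, if_pos hj]
    · rw [Finset.mul_sum, Real.exp_sum]
      refine Finset.prod_le_prod (fun k hk => ?_) fun k hk => ?_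
      · refine integral_nonneg fun s => ?_
        simp only [hg, if_neg (Finset.mem_compl.1 hk)]
        exact (Real.exp_pos _).le
      · have hk' := Finset.mem_compl.1 hk
        obtain ⟨h0, h1⟩ := hlam k hk'
        simp only [hg, if_neg hk']
        rw [integral_exp_mul_gammaMeasure_one hα0 (by linarith)]
        -- For 0 ≤ y ≤ 1/2 one has 1/(1 - y) ≤ 1 + 2y ≤ e^{2y}, which explains both the bound 1/2 on
        -- θ λ_k and the factor 2 in the exponent.
        have h2 : Real.exp (-(2 * (θ * lam k))) ≤ 1 - θ * lam k := by
          have h3 := Real.add_one_le_exp (2 * (θ * lam k))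
          rw [Real.exp_neg]
          refine inv_le_of_inv_le₀ (by linarith) ?_
          refine le_trans ?_ h3
          rw [inv_le_iff_one_le_mul₀ (by linarith)]
          nlinarith
        calc (1 - θ * lam k) ^ (-α) ≤ (Real.exp (-(2 * (θ * lam k)))) ^ (-α) :=
              Real.rpow_le_rpow_of_nonpos (Real.exp_pos _) h2 (by linarith)
          _ = _ := by rw [← Real.exp_mul]; ring_nf
    · refine Finset.prod_nonneg fun k hk => integral_nonneg fun s => ?_
      simp only [hg, if_neg (Finset.mem_compl.1 hk)]
      exact (Real.exp_pos _).le
  · filter_upwards [gammaPi_ae_pos] with u hu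
    refine Finset.prod_nonneg fun k _ => ?_
    simp only [hg]
    split_ifs
    · exact (hu k).le
    · exact zero_le_one
    · exact (Real.exp_pos _).le

/-- The kernel is small where the weighted sum over `B` is small, since there the remaining
coordinates have to be exceptionally large. -/
theorem lintegral_radialKernel_small_le (f : SmoothStep) (hα2 : 1 / 2 ≤ α) {B : Finset ι}
    {o i j : ι} (ho : o ∈ B) (hi : i ∈ B) (hj : j ∈ B) (hoi : o ≠ i) (hoj : o ≠ j) (hij : i ≠ j)
    {lam : ι → ℝ} (hlamB : ∀ k ∈ B, 0 < lam k) (hlamo : lam o = 1) {θ : ℝ} (hθ : 0 ≤ θ)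
    (hlam : ∀ k ∉ B, 0 ≤ θ * lam k ∧ θ * lam k ≤ 1 / 2) {r : ℝ} (hr : 0 < r) (x : ℝ) :
    ∫⁻ u, (if ∑ k ∈ B, lam k * u k < r then ENNReal.ofReal (radialKernel f B lam x i j u) else 0)
      ∂gammaPi (fun _ : ι => α) ≤
    ENNReal.ofReal (α * Real.exp (2 * θ * α * ∑ k ∈ Bᶜ, lam k - θ * (x - 1 - r)) *
      (r ^ (2 * α - 1) / (α * Real.Gamma α ^ 2) * lam i ^ (-(α + 1)))) * f.mass := by
  have hη := f.continuous_η.measurable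
  have hα0 := hα.out
  have hΓ := Real.Gamma_pos_of_pos hα0
  have hli := hlamB i hi
  -- E is the Chernoff weight times u_j and does not involve u_o or u_i. J keeps only u_o + λ_i u_i
  -- from the denominator, so integrating out these two coordinates bounds J uniformly in the
  -- others.
  set E : (ι → ℝ) → ENNReal := fun u =>
    ENNReal.ofReal (Real.exp (θ * ∑ k ∈ Bᶜ, lam k * u k) * u j) with hE
  set J : (ι → ℝ) → ENNReal := fun u => if u o + lam i * u i < r then
    ENNReal.ofReal (u i * f.η (x - ∑ k, lam k * u k) / (u o + lam i * u i)) else 0 with hJ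
  have hEm : Measurable E := by fun_prop
  have hJm : Measurable J :=
    Measurable.ite (measurableSet_lt (by fun_prop) measurable_const) (by fun_prop) measurable_const
  have hEu : ∀ k ∈ B, k ≠ j → ∀ u s, E (Function.update u k s) = E u := by
    intro k hk hkj u s
    simp only [hE]
    rw [sum_mul_update_of_notMem _ _ _ (by simpa using hk), Function.update_of_ne hkj.symm]
  set D := ENNReal.ofReal (Real.exp (-(θ * (x - 1 - r)))) with hD
  set G := ENNReal.ofReal (r ^ (2 * α - 1) / (α * Real.Gamma α ^ 2) * lam i ^ (-(α + 1))) * f.mass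
    with hGdef
  calc _ ≤ ∫⁻ u, D * (E u * J u) ∂gammaPi (fun _ : ι => α) := by
        refine lintegral_mono_ae ?_
        filter_upwards [gammaPi_ae_pos] with u hu
        split_ifs with hL
        swap
        · exact zero_le
        by_cases hx : x - ∑ k, lam k * u k ∈ Icc (0 : ℝ) 1
        swap
        · simp [radialKernel, f.η_eq_zero _ hx]
        have hsplit := Finset.sum_add_sum_compl B fun k => lam k * u k
        have hpair : u o + lam i * u i ≤ ∑ k ∈ B, lam k * u k := by
          have h1 := Finset.sum_le_sum_of_subset_of_nonneg (f := fun k => lam k * u k)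
            (s := {o, i}) (t := B) (by intro k; simp; rintro (rfl | rfl) <;> assumption)
            (fun k hk _ => (mul_pos (hlamB k hk) (hu k)).le)
          rwa [Finset.sum_pair hoi, hlamo, one_mul] at h1
        have hpos : 0 < u o + lam i * u i := add_pos (hu o) (mul_pos hli (hu i))
        simp only [hE, hJ, hD]
        rw [if_pos (hpair.trans_lt hL), ← ENNReal.ofReal_mul (by have := hu j; positivity),
          ← ENNReal.ofReal_mul (Real.exp_pos _).le]
        refine ENNReal.ofReal_le_ofReal ?_
        -- Chernoff: η ≠ 0 needs S ≥ x - 1, and the part of S over B is below r, so the complement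
        -- supplies at least x - 1 - r.
        have hexp : 1 ≤ Real.exp (-(θ * (x - 1 - r))) * Real.exp (θ * ∑ k ∈ Bᶜ, lam k * u k) := by
          rw [← Real.exp_add]
          refine Real.one_le_exp ?_
          have : x - 1 - r ≤ ∑ k ∈ Bᶜ, lam k * u k := by linarith [hx.2]
          nlinarith
        have hq : 0 ≤ u i * u j * f.η (x - ∑ k, lam k * u k) :=
          mul_nonneg (mul_pos (hu i) (hu j)).le (f.η_nonneg _)
        calc radialKernel f B lam x i j u
            ≤ u i * u j * f.η (x - ∑ k, lam k * u k) / (u o + lam i * u i) := by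
              rw [radialKernel]
              gcongr
          _ ≤ (Real.exp (-(θ * (x - 1 - r))) * Real.exp (θ * ∑ k ∈ Bᶜ, lam k * u k)) *
              (u i * u j * f.η (x - ∑ k, lam k * u k) / (u o + lam i * u i)) :=
              le_mul_of_one_le_left (by positivity) hexp
          _ = _ := by ring
    _ = D * ∫⁻ u, E u * J u ∂gammaPi (fun _ : ι => α) := lintegral_const_mul _ (by fun_prop)
    _ = D * ∫⁻ u, ∫⁻ s, ∫⁻ v, E (Function.update (Function.update u o s) i v) *
          J (Function.update (Function.update u o s) i v) ∂gammaMeasure α 1 ∂gammaMeasure α 1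
          ∂gammaPi (fun _ : ι => α) := by
        congr 1
        have hm : Measurable fun u => E u * J u := hEm.mul hJm
        have hm' : Measurable fun z : (ι → ℝ) × ℝ =>
            E (Function.update z.1 i z.2) * J (Function.update z.1 i z.2) :=
          hm.comp measurable_update'
        rw [lintegral_gammaPi_update (p := fun _ => α) i hm,
          lintegral_gammaPi_update (p := fun _ => α) o hm'.lintegral_prod_right']
    _ ≤ D * ∫⁻ u, E u * G ∂gammaPi (fun _ : ι => α) := by
        gcongr with u
        have h1 : ∀ s v, E (Function.update (Function.update u o s) i v) = E u := fun s v => by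
          rw [hEu i hi hij, hEu o ho hoj]
        simp only [h1]
        have hJu : ∀ s v, J (Function.update (Function.update u o s) i v) =
            if s + lam i * v < r then ENNReal.ofReal (v *
              f.η (x - (∑ k, lam k * u k - u o - lam i * u i) - (s + lam i * v)) /
                (s + lam i * v)) else 0 := by
          intro s v
          simp only [hJ]
          rw [sum_mul_update _ _ _ (Finset.mem_univ _), sum_mul_update _ _ _ (Finset.mem_univ _),
            Function.update_self, Function.update_of_ne hoi, Function.update_self,
            Function.update_of_ne hoi.symm, hlamo]
          congr 4
          ring_nf
        simp only [hJu]
        have hm : Measurable fun z : ℝ × ℝ => (if z.1 + lam i * z.2 < r then ENNReal.ofReal (z.2 *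
              f.η (x - (∑ k, lam k * u k - u o - lam i * u i) - (z.1 + lam i * z.2)) /
                (z.1 + lam i * z.2)) else 0) :=
          Measurable.ite (measurableSet_lt (by fun_prop) measurable_const) (by fun_prop)
            measurable_const
        have h2 : ∀ s, ∫⁻ v, E u * (if s + lam i * v < r then ENNReal.ofReal (v *
              f.η (x - (∑ k, lam k * u k - u o - lam i * u i) - (s + lam i * v)) /
                (s + lam i * v)) else 0) ∂gammaMeasure α 1 = E u *
            ∫⁻ v, (if s + lam i * v < r then ENNReal.ofReal (v *
              f.η (x - (∑ k, lam k * u k - u o - lam i * u i) - (s + lam i * v)) /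
                (s + lam i * v)) else 0) ∂gammaMeasure α 1 := fun s =>
          lintegral_const_mul _ (hm.comp measurable_prodMk_left)
        simp only [h2]
        rw [lintegral_const_mul _ hm.lintegral_prod_right']
        gcongr
        exact lintegral_two_gamma_le f hα2 hli hr _
    _ = D * ((∫⁻ u, E u ∂gammaPi (fun _ : ι => α)) * G) := by rw [lintegral_mul_const _ hEm]
    _ ≤ D * (ENNReal.ofReal (α * Real.exp (2 * θ * α * ∑ k ∈ Bᶜ, lam k)) * G) := by
        gcongr
        exact lintegral_exp_sum_mul_le hj hlam
    _ = _ := by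
        rw [hGdef, hD, ← mul_assoc, ← mul_assoc, ← ENNReal.ofReal_mul (Real.exp_pos _).le,
          ← ENNReal.ofReal_mul (by positivity)]
        congr 2
        rw [sub_eq_add_neg _ (θ * (x - 1 - r)), Real.exp_add]
        ring

end

/-! ### The contribution of large weighted sums over B -/

section

variable {ι : Type*} [Fintype ι] [DecidableEq ι] {α : ℝ} [hα : Fact (0 < α)]

theorem gammaMeasure_real_Icc_pos : 0 < (gammaMeasure α 1).real (Icc 1 2) := by
  have hα0 := hα.out
  have hΓ := Real.Gamma_pos_of_pos hα0
  rw [measureReal_def]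
  refine ENNReal.toReal_pos ?_ (measure_ne_top _ _)
  rw [gammaMeasure, withDensity_apply _ measurableSet_Icc]
  refine (setLIntegral_pos_iff (measurable_gammaPDFReal α 1).ennreal_ofReal).2 ?_ |>.ne'
  have : Icc (1 : ℝ) 2 ⊆ Function.support (gammaPDF α 1) ∩ Icc 1 2 := by
    intro s hs
    refine ⟨?_, hs⟩
    have := gammaPDFReal_pos hα0 one_pos (zero_lt_one.trans_le hs.1)
    simpa [gammaPDF] using this
  refine lt_of_lt_of_le ?_ (measure_mono this)
  simp

theorem gammaPi_box (B : Finset ι) :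
    (gammaPi fun _ : ι => α) {u | ∀ k ∈ B, u k ∈ Icc (1 : ℝ) 2} =
      (gammaMeasure α 1 (Icc 1 2)) ^ B.card := by
  have : {u : ι → ℝ | ∀ k ∈ B, u k ∈ Icc (1 : ℝ) 2} =
      univ.pi fun k => if k ∈ B then Icc (1 : ℝ) 2 else univ := by
    ext u
    simp only [mem_ofPred_eq, mem_univ_pi]
    refine forall_congr' fun k => ?_
    split_ifs with h <;> simp [h]
  rw [this, Measure.pi_pi]
  simp only [apply_ite (gammaMeasure α 1), measure_univ]
  rw [Finset.prod_ite_mem, Finset.univ_inter, Finset.prod_const]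

/-- Markov's inequality: the mean is at most αM, at most half the threshold. The `+ 1` keeps the
threshold positive when M = 0. -/
theorem half_le_gammaPi_sum_le {T : Finset ι} {lam : ι → ℝ} (hlam : ∀ k, 0 ≤ lam k) {M : ℝ}
    (hM : ∑ k ∈ T, lam k ≤ M) :
    1 / 2 ≤ (gammaPi fun _ : ι => α).real {u | ∑ k ∈ T, lam k * u k ≤ 2 * α * M + 1} := by
  have hα0 := hα.out
  have hM0 : 0 ≤ M := (Finset.sum_nonneg fun k _ => hlam k).trans hM
  have hi : Integrable (fun u : ι → ℝ => ∑ k ∈ T, lam k * u k) (gammaPi fun _ : ι => α) :=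
    integrable_finsetSum _ fun k _ => (integrable_eval_gammaPi k).const_mul _
  have h1 := mul_meas_ge_le_integral_of_nonneg (μ := gammaPi fun _ : ι => α)
    (f := fun u => ∑ k ∈ T, lam k * u k) (by
      filter_upwards [gammaPi_ae_pos] with u hu
      exact Finset.sum_nonneg fun k _ => mul_nonneg (hlam k) (hu k).le) hi (2 * α * M + 1)
  rw [integral_finsetSum _ fun k _ => (integrable_eval_gammaPi k).const_mul _] at h1
  simp only [integral_const_mul, integral_eval_gammaPi] at h1
  rw [← Finset.sum_mul] at h1
  have h2 : {u : ι → ℝ | ∑ k ∈ T, lam k * u k ≤ 2 * α * M + 1}ᶜ ⊆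
      {u | 2 * α * M + 1 ≤ ∑ k ∈ T, lam k * u k} := by
    intro u hu
    simp only [mem_compl_iff, mem_ofPred_eq, not_le] at hu ⊢
    exact hu.le
  have h3 := measureReal_mono (μ := gammaPi fun _ : ι => α) h2
  rw [probReal_compl_eq_one_sub (measurableSet_le (by fun_prop) measurable_const)] at h3
  have h4 : (0 : ℝ) < 2 * α * M + 1 := by positivity
  have h5 : (gammaPi fun _ : ι => α).real {u | 2 * α * M + 1 ≤ ∑ k ∈ T, lam k * u k} ≤ 1 / 2 := by
    rw [← mul_le_mul_iff_right₀ h4]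
    refine h1.trans ?_
    nlinarith
  linarith

/-- The two events depend on disjoint sets of coordinates, hence are independent. The bound does not
depend on the size of T. -/
theorem le_gammaPi_box_inter {S T : Finset ι} (hST : Disjoint S T) {lam : ι → ℝ}
    (hlam : ∀ k, 0 ≤ lam k) {M : ℝ} (hM : ∑ k ∈ T, lam k ≤ M) :
    ENNReal.ofReal ((gammaMeasure α 1).real (Icc 1 2) ^ S.card / 2) ≤
      (gammaPi fun _ : ι => α) ({u | ∀ k ∈ S, u k ∈ Icc (1 : ℝ) 2} ∩
        {u | ∑ k ∈ T, lam k * u k ≤ 2 * α * M + 1}) := by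
  have hind : iIndepFun (fun (k : ι) (u : ι → ℝ) => u k) (gammaPi fun _ : ι => α) :=
    iIndepFun_pi (X := fun _ => id) fun _ => aemeasurable_id
  have h := (hind.indepFun_finset S T hST fun k => measurable_pi_apply k)
  have hA : MeasurableSet {v : S → ℝ | ∀ k, v k ∈ Icc (1 : ℝ) 2} := by
    have : {v : S → ℝ | ∀ k, v k ∈ Icc (1 : ℝ) 2} = univ.pi fun _ => Icc 1 2 := by
      ext v; simp only [mem_ofPred_eq, mem_univ_pi]
    rw [this]
    exact MeasurableSet.univ_pi fun _ => measurableSet_Icc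
  have hB : MeasurableSet {v : T → ℝ | ∑ k : T, lam k * v k ≤ 2 * α * M + 1} :=
    measurableSet_le (by fun_prop) measurable_const
  have e := h.measure_inter_preimage_eq_mul _ _ hA hB
  have e1 : (fun (u : ι → ℝ) (k : S) => u k) ⁻¹' {v : S → ℝ | ∀ k, v k ∈ Icc (1 : ℝ) 2} =
      {u | ∀ k ∈ S, u k ∈ Icc (1 : ℝ) 2} := by
    ext u; simp
  have e2 : (fun (u : ι → ℝ) (k : T) => u k) ⁻¹'
      {v : T → ℝ | ∑ k : T, lam k * v k ≤ 2 * α * M + 1} =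
      {u | ∑ k ∈ T, lam k * u k ≤ 2 * α * M + 1} := by
    ext u
    simp only [mem_preimage, mem_ofPred_eq]
    rw [Finset.sum_coe_sort T fun k => lam k * u k]
  rw [e1, e2, gammaPi_box] at e
  rw [e, div_eq_mul_one_div, ENNReal.ofReal_mul (by positivity),
    ENNReal.ofReal_pow measureReal_nonneg, ofReal_measureReal]
  gcongr
  rw [ENNReal.ofReal_le_iff_le_toReal (measure_ne_top _ _)]
  exact half_le_gammaPi_sum_le hlam hM

/-- Since α - 1 may be negative, s^(α-1) is bounded below by s⁻¹ ≥ e^{-s}; the second e^{-s} is the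
one in the density. -/
theorem exp_le_gammaDensity {s x : ℝ} (hs : 1 ≤ s) (hsx : s ≤ x) :
    Real.exp (-(2 * x)) / Real.Gamma α ≤ 1 / Real.Gamma α * s ^ (α - 1) * Real.exp (-s) := by
  have hα0 := hα.out
  have hΓ := Real.Gamma_pos_of_pos hα0
  have h1 : Real.exp (-s) ≤ s ^ (α - 1) := by
    calc Real.exp (-s) ≤ s⁻¹ := by
          rw [Real.exp_neg]
          exact inv_anti₀ (by linarith) (by linarith [Real.add_one_le_exp s])
      _ = s ^ (-1 : ℝ) := (Real.rpow_neg_one s).symm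
      _ ≤ _ := Real.rpow_le_rpow_of_exponent_le hs (by linarith)
  calc Real.exp (-(2 * x)) / Real.Gamma α
      ≤ Real.exp (-s + -s) / Real.Gamma α := by gcongr; linarith
    _ = 1 / Real.Gamma α * Real.exp (-s) * Real.exp (-s) := by rw [Real.exp_add]; ring
    _ ≤ _ := by gcongr

/-- The support of s ↦ η(z - s) lies in [z - 1, z], inside [1, x], where the density is at least
e^{-2x}/Γ(α). -/
theorem mass_le_lintegral_η_gamma (f : SmoothStep) {z x : ℝ} (hz : 2 ≤ z) (hzx : z ≤ x) :
    ENNReal.ofReal (Real.exp (-(2 * x)) / Real.Gamma α) * f.mass ≤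
      ∫⁻ s, ENNReal.ofReal (f.η (z - s)) ∂gammaMeasure α 1 := by
  have hα0 := hα.out
  have hη := f.continuous_η.measurable
  rw [lintegral_gammaMeasure_one _ (by fun_prop), ← f.lintegral_η_sub z,
    ← lintegral_const_mul _ (by fun_prop), ← lintegral_indicator measurableSet_Ioi]
  refine lintegral_mono fun s => ?_
  by_cases h : z - s ∈ Icc (0 : ℝ) 1
  · have hs : 1 ≤ s := by linarith [h.2]
    rw [indicator_of_mem (show s ∈ Ioi (0 : ℝ) from zero_lt_one.trans_le hs)]
    gcongr
    exact exp_le_gammaDensity hs (by linarith [h.1])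
  · simp [f.η_eq_zero _ h]

/-- Lower bound for the contribution of configurations with a large weighted sum over `B`. -/
theorem le_lintegral_weight_large (f : SmoothStep) {B : Finset ι}
    {o i j : ι} (ho : o ∈ B) (hi : i ∈ B) (hj : j ∈ B) (hoi : o ≠ i) (hoj : o ≠ j)
    {lam : ι → ℝ} (hlam : ∀ k, 0 ≤ lam k) (hlamo : lam o = 1) {M : ℝ} (hM : ∑ k, lam k ≤ M)
    {r x : ℝ} (hr : 1 ≤ r) (hx : r + 2 * M + 2 * α * M + 2 ≤ x) :
    ENNReal.ofReal ((gammaMeasure α 1).real (Icc 1 2) ^ B.card / 2 *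
      (Real.exp (-(2 * x)) / Real.Gamma α)) * f.mass ≤
    ∫⁻ u, (if r ≤ ∑ k ∈ B, lam k * u k then
      ENNReal.ofReal (u i * u j * f.η (x - ∑ k, lam k * u k)) else 0)
      ∂gammaPi (fun _ : ι => α) := by
  have hη := f.continuous_η.measurable
  have hα0 := hα.out
  have hΓ := Real.Gamma_pos_of_pos hα0
  have hM0 : 0 ≤ M := (Finset.sum_nonneg fun k _ => hlam k).trans hM
  -- On E every coordinate but u_o contributes a bounded amount to S. The coordinate u_o has weight
  -- 1 and alone brings S into the window where η lives.
  set E : Set (ι → ℝ) := {u | ∀ k ∈ B.erase o, u k ∈ Icc (1 : ℝ) 2} ∩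
        {u | ∑ k ∈ Bᶜ, lam k * u k ≤ 2 * α * M + 1} with hE
  have hdisj : Disjoint (B.erase o) Bᶜ :=
    Finset.disjoint_of_subset_left (Finset.erase_subset _ _) disjoint_compl_right
  have hMT : ∑ k ∈ Bᶜ, lam k ≤ M := (Finset.sum_le_sum_of_subset_of_nonneg
    (Finset.subset_univ _) fun k _ _ => hlam k).trans hM
  have hMB : ∑ k ∈ B.erase o, lam k ≤ M := (Finset.sum_le_sum_of_subset_of_nonneg
    (Finset.subset_univ _) fun k _ _ => hlam k).trans hM
  have hEle := le_gammaPi_box_inter (α := α) hdisj hlam hMT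
  have hEmeas : MeasurableSet E := by
    refine MeasurableSet.inter ?_ (measurableSet_le (by fun_prop) measurable_const)
    simp only [ofPred_forall]
    exact MeasurableSet.iInter fun k => MeasurableSet.iInter fun _ =>
      measurableSet_Icc.preimage (measurable_pi_apply k)
  have hm : Measurable fun u : ι → ℝ => (if r ≤ ∑ k ∈ B, lam k * u k then
      ENNReal.ofReal (u i * u j * f.η (x - ∑ k, lam k * u k)) else 0) :=
    Measurable.ite (measurableSet_le measurable_const (by fun_prop)) (by fun_prop) measurable_const
  rw [lintegral_gammaPi_update (p := fun _ => α) o hm]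
  have hq : (gammaMeasure α 1).real (Icc 1 2) ^ B.card ≤
      (gammaMeasure α 1).real (Icc 1 2) ^ (B.erase o).card :=
    pow_le_pow_of_le_one measureReal_nonneg measureReal_le_one (Finset.card_erase_le)
  calc _ ≤ ENNReal.ofReal ((gammaMeasure α 1).real (Icc 1 2) ^ (B.erase o).card / 2) *
        (ENNReal.ofReal (Real.exp (-(2 * x)) / Real.Gamma α) * f.mass) := by
        rw [ENNReal.ofReal_mul (by positivity), mul_assoc]
        gcongr
    _ ≤ (gammaPi fun _ : ι => α) E *
        (ENNReal.ofReal (Real.exp (-(2 * x)) / Real.Gamma α) * f.mass) := by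
        gcongr
    _ = ∫⁻ u, E.indicator (fun _ => ENNReal.ofReal (Real.exp (-(2 * x)) / Real.Gamma α) * f.mass) u
          ∂gammaPi (fun _ : ι => α) := by
        rw [lintegral_indicator hEmeas, setLIntegral_const, mul_comm]
    _ ≤ _ := by
        refine lintegral_mono_ae ?_
        filter_upwards [gammaPi_ae_pos] with u hu
        by_cases hu' : u ∈ E
        swap
        · rw [indicator_of_notMem hu']; exact zero_le
        rw [indicator_of_mem hu']
        obtain ⟨h1, h2⟩ := hu'
        simp only [mem_ofPred_eq] at h1 h2
        have hsplit := Finset.sum_add_sum_compl B fun k => lam k * u k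
        have hBo := Finset.add_sum_erase B (fun k => lam k * u k) ho
        simp only [hlamo, one_mul] at hBo
        have hBe : ∑ k ∈ B.erase o, lam k * u k ≤ 2 * M := by
          calc _ ≤ ∑ k ∈ B.erase o, lam k * 2 := Finset.sum_le_sum fun k hk =>
                mul_le_mul_of_nonneg_left (h1 k hk).2 (hlam k)
            _ ≤ _ := by rw [← Finset.sum_mul]; linarith
        have hBe0 : 0 ≤ ∑ k ∈ B.erase o, lam k * u k :=
          Finset.sum_nonneg fun k _ => mul_nonneg (hlam k) (hu k).le
        have hBc0 : 0 ≤ ∑ k ∈ Bᶜ, lam k * u k :=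
          Finset.sum_nonneg fun k _ => mul_nonneg (hlam k) (hu k).le
        -- The value of u_o for which S = x, the other coordinates being fixed.
        set z := x - (∑ k, lam k * u k - u o) with hz
        have hz1 : r + 1 ≤ z := by rw [hz]; linarith
        have hz2 : z ≤ x := by rw [hz]; linarith
        refine (mass_le_lintegral_η_gamma f (by linarith) hz2).trans ?_
        refine lintegral_mono fun s => ?_
        by_cases h : z - s ∈ Icc (0 : ℝ) 1
        swap
        · simp [f.η_eq_zero _ h]
        have hsB : r ≤ ∑ k ∈ B, lam k * Function.update u o s k := by
          rw [sum_mul_update _ _ _ ho, hlamo]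
          linarith [h.2]
        have hsS : x - ∑ k, lam k * Function.update u o s k = z - s := by
          rw [sum_mul_update _ _ _ (Finset.mem_univ o), hlamo]
          ring
        simp only
        rw [if_pos hsB, hsS, Function.update_of_ne hoi.symm, Function.update_of_ne hoj.symm]
        refine ENNReal.ofReal_le_ofReal ?_
        have hui := (h1 i (Finset.mem_erase.2 ⟨hoi.symm, hi⟩)).1
        have huj := (h1 j (Finset.mem_erase.2 ⟨hoj.symm, hj⟩)).1
        refine le_mul_of_one_le_left (f.η_nonneg _) ?_
        nlinarith

end

/-! ### The threshold that does not depend on the number of weights -/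

theorem exists_exp_mul_rpow_le {β : ℝ} (hβ : 0 ≤ β) (D : ℝ) {K c : ℝ} (hK : 0 ≤ K) (hc : 0 < c) :
    ∃ x₀ : ℝ, ∀ x ≥ x₀, ∀ a : ℝ, 0 < a →
      K * (Real.exp (-(1 / (2 * min a (1 / 32)) * (x - D))) * a ^ (-β)) ≤
        c * Real.exp (-(2 * x)) := by
  set n := ⌈β⌉₊ with hn
  -- The first two bounds make the exponent large enough; the third lets a spare e^{-2x} absorb the
  -- constants.
  refine ⟨max (max (2 * D) 8) (K * n.factorial / c), fun x hx a ha => ?_⟩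
  have hx1 : 2 * D ≤ x := (le_max_left _ _).trans ((le_max_left _ _).trans hx)
  have hx2 : 8 ≤ x := (le_max_right _ _).trans ((le_max_left _ _).trans hx)
  have hx3 : K * n.factorial / c ≤ x := (le_max_right _ _).trans hx
  set m := min a (1 / 32) with hm
  have hm0 : 0 < m := lt_min ha (by norm_num)
  set y := m⁻¹ with hy
  have hy0 : 0 < y := inv_pos.2 hm0
  have hy32 : 32 ≤ y := by
    rw [hy, le_inv_comm₀ (by norm_num) hm0]
    exact (min_le_right _ _).trans (by norm_num)
  have e1 : a ^ (-β) ≤ n.factorial * Real.exp y := by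
    calc a ^ (-β) ≤ m ^ (-β) :=
          Real.rpow_le_rpow_of_nonpos hm0 (min_le_left _ _) (by linarith)
      _ = y ^ β := by rw [Real.rpow_neg hm0.le, hy, Real.inv_rpow hm0.le]
      _ ≤ y ^ (n : ℝ) := Real.rpow_le_rpow_of_exponent_le (by linarith) (Nat.le_ceil β)
      _ = y ^ n := Real.rpow_natCast _ _
      _ ≤ _ := by
          have := Real.pow_div_factorial_le_exp y hy0.le n
          rwa [div_le_iff₀' (by positivity)] at this
  have e2 : 1 / (2 * m) * (x - D) = y * (x - D) / 2 := by
    rw [hy]; field_simp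
  -- From x ≥ 2D the right side is at least yx/4; half of that exceeds y since x ≥ 8, and the other
  -- half exceeds 4x since y ≥ 32. This is the origin of the cutoff 1/32: e^{-y} pays for a^(-β),
  -- and e^{-4x} is left.
  have e3 : y + 4 * x ≤ y * (x - D) / 2 := by nlinarith
  calc K * (Real.exp (-(1 / (2 * m) * (x - D))) * a ^ (-β))
      ≤ K * (Real.exp (-(y + 4 * x)) * (n.factorial * Real.exp y)) := by
        rw [e2]
        gcongr
    _ = K * n.factorial * Real.exp (-(2 * x)) * Real.exp (-(2 * x)) := by
        rw [show -(y + 4 * x) = -(2 * x) + -(2 * x) + -y by ring, Real.exp_add, Real.exp_add,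
          Real.exp_neg y]
        field_simp
    _ ≤ c * Real.exp (-(2 * x)) := by
        gcongr
        rw [Real.exp_neg, ← div_eq_mul_inv, div_le_iff₀ (Real.exp_pos _), ← div_le_iff₀' hc]
        linarith [Real.add_one_le_exp (2 * x)]

section

variable {ι : Type*} [Fintype ι] [DecidableEq ι] {α : ℝ} [hα : Fact (0 < α)]

/-- Where L ≥ 2A, ∑_B u_k ≥ L gives ∑_B u_k - A ≥ L/2, and K L = u_i u_j η. Where L < 2A the second
factor is at least -A. So the integrand dominates G - H, and `hnum` compares the bounds for the two
parts; both carry the total mass of η, so the condition is independent of the step. -/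
theorem integral_radialKernel_nonneg_of_le (f : SmoothStep) (hα2 : 1 / 2 ≤ α) {B : Finset ι}
    {o i j : ι} (ho : o ∈ B) (hi : i ∈ B) (hj : j ∈ B) (hoi : o ≠ i) (hoj : o ≠ j) (hij : i ≠ j)
    {lam : ι → ℝ} (hlamB : ∀ k ∈ B, 0 < lam k) (hlam0 : ∀ k, 0 ≤ lam k) (hlam1 : ∀ k, lam k ≤ 1)
    (hlamo : lam o = 1) {M : ℝ} (hM : ∑ k, lam k ≤ M) {θ : ℝ} (hθ : 0 ≤ θ)
    (hlam : ∀ k ∉ B, θ * lam k ≤ 1 / 2) {A x : ℝ} (hA : B.card * α + 1 ≤ A)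
    (hx : 2 * A + 2 * M + 2 * α * M + 2 ≤ x)
    (hnum : A * (α * Real.exp (2 * θ * α * M - θ * (x - 1 - 2 * A)) *
      ((2 * A) ^ (2 * α - 1) / (α * Real.Gamma α ^ 2) * lam i ^ (-(α + 1)))) ≤
      1 / 2 * ((gammaMeasure α 1).real (Icc 1 2) ^ B.card / 2 *
      (Real.exp (-(2 * x)) / Real.Gamma α))) :
    0 ≤ ∫ u, radialKernel f B lam x i j u * (∑ k ∈ B, u k - (∑ _k ∈ B, α + 1))
      ∂gammaPi (fun _ : ι => α) := by
  have hη := f.continuous_η.measurable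
  have hα0 := hα.out
  have hΓ := Real.Gamma_pos_of_pos hα0
  have hli := hlamB i hi
  have hA1 : 1 ≤ A := le_trans (by nlinarith [Nat.cast_nonneg (α := ℝ) B.card]) hA
  have hMT : ∑ k ∈ Bᶜ, lam k ≤ M := (Finset.sum_le_sum_of_subset_of_nonneg
    (Finset.subset_univ _) fun k _ _ => hlam0 k).trans hM
  set G : (ι → ℝ) → ℝ := fun u => if 2 * A ≤ ∑ k ∈ B, lam k * u k then
    1 / 2 * (u i * u j * f.η (x - ∑ k, lam k * u k)) else 0 with hG
  set H : (ι → ℝ) → ℝ := fun u => if ∑ k ∈ B, lam k * u k < 2 * A then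
    A * radialKernel f B lam x i j u else 0 with hH
  have hGm : Measurable G :=
    Measurable.ite (measurableSet_le measurable_const (by fun_prop)) (by fun_prop) measurable_const
  have hHm : Measurable H :=
    Measurable.ite (measurableSet_lt (by fun_prop) measurable_const)
      (measurable_radialKernel.const_mul _) measurable_const
  have hG0 : ∀ᵐ u ∂gammaPi (fun _ : ι => α), 0 ≤ G u := by
    filter_upwards [gammaPi_ae_pos] with u hu
    simp only [hG]
    split_ifs
    · have := mul_nonneg (mul_pos (hu i) (hu j)).le (f.η_nonneg (x - ∑ k, lam k * u k))
      linarith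
    · exact le_rfl
  have hH0 : ∀ᵐ u ∂gammaPi (fun _ : ι => α), 0 ≤ H u := by
    filter_upwards [gammaPi_ae_pos] with u hu
    simp only [hH]
    split_ifs
    · exact mul_nonneg (by linarith) (radialKernel_nonneg hlamB hi hu)
    · exact le_rfl
  have hK := integrable_radialKernel (p := fun _ => α) (f := f) (x := x) (j := j) hlamB hi
  have hGi : Integrable G (gammaPi fun _ : ι => α) := by
    refine ((integrable_eval_mul_eval_gammaPi i j).const_mul (f.C)).mono'
      hGm.aestronglyMeasurable ?_
    filter_upwards [gammaPi_ae_pos, hG0] with u hu hu0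
    rw [Real.norm_of_nonneg hu0]
    simp only [hG]
    have hw := mul_pos (hu i) (hu j)
    have h1 := mul_le_mul_of_nonneg_left (f.η_le (x - ∑ k, lam k * u k)) hw.le
    have h2 := mul_nonneg hw.le (f.η_nonneg (x - ∑ k, lam k * u k))
    split_ifs <;> linarith
  have hHi : Integrable H (gammaPi fun _ : ι => α) := by
    refine (hK.const_mul A).mono' hHm.aestronglyMeasurable ?_
    filter_upwards [gammaPi_ae_pos, hH0] with u hu hu0
    rw [Real.norm_of_nonneg hu0]
    simp only [hH]
    split_ifs
    · exact le_rfl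
    · exact mul_nonneg (by linarith) (radialKernel_nonneg hlamB hi hu)
  have hHG : ∫ u, H u ∂gammaPi (fun _ : ι => α) ≤ ∫ u, G u ∂gammaPi (fun _ : ι => α) := by
    rw [← ENNReal.ofReal_le_ofReal_iff (integral_nonneg_of_ae hG0),
      ofReal_integral_eq_lintegral_ofReal hHi hH0, ofReal_integral_eq_lintegral_ofReal hGi hG0]
    have eH : ∀ u, ENNReal.ofReal (H u) = ENNReal.ofReal A *
        (if ∑ k ∈ B, lam k * u k < 2 * A then
          ENNReal.ofReal (radialKernel f B lam x i j u) else 0) := by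
      intro u
      simp only [hH]
      split_ifs
      · rw [ENNReal.ofReal_mul (by linarith)]
      · simp
    have eG : ∀ u, ENNReal.ofReal (G u) = ENNReal.ofReal (1 / 2) *
        (if 2 * A ≤ ∑ k ∈ B, lam k * u k then
          ENNReal.ofReal (u i * u j * f.η (x - ∑ k, lam k * u k)) else 0) := by
      intro u
      simp only [hG]
      split_ifs
      · rw [ENNReal.ofReal_mul (by norm_num)]
      · simp
    simp only [eH, eG]
    have mH : Measurable fun u : ι → ℝ => (if ∑ k ∈ B, lam k * u k < 2 * A then
          ENNReal.ofReal (radialKernel f B lam x i j u) else 0) :=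
      Measurable.ite (measurableSet_lt (by fun_prop) measurable_const)
        measurable_radialKernel.ennreal_ofReal measurable_const
    have mG : Measurable fun u : ι → ℝ => (if 2 * A ≤ ∑ k ∈ B, lam k * u k then
          ENNReal.ofReal (u i * u j * f.η (x - ∑ k, lam k * u k)) else 0) :=
      Measurable.ite (measurableSet_le measurable_const (by fun_prop)) (by fun_prop)
        measurable_const
    rw [lintegral_const_mul _ mH, lintegral_const_mul _ mG]
    have b1 := lintegral_radialKernel_small_le f hα2 ho hi hj hoi hoj hij hlamB hlamo hθ
      (fun k hk => ⟨mul_nonneg hθ (hlam0 k), hlam k hk⟩) (r := 2 * A) (by linarith) x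
    have b2 := le_lintegral_weight_large (α := α) f ho hi hj hoi hoj hlam0 hlamo hM
      (r := 2 * A) (x := x) (by linarith) (by linarith)
    calc _ ≤ ENNReal.ofReal A * _ := mul_le_mul_right b1 _
      _ ≤ ENNReal.ofReal (1 / 2) * (ENNReal.ofReal ((gammaMeasure α 1).real (Icc 1 2) ^ B.card / 2 *
          (Real.exp (-(2 * x)) / Real.Gamma α)) * f.mass) := by
          rw [← mul_assoc, ← ENNReal.ofReal_mul (by linarith), ← mul_assoc (ENNReal.ofReal (1 / 2)),
            ← ENNReal.ofReal_mul (by norm_num)]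
          refine mul_le_mul_left (ENNReal.ofReal_le_ofReal (le_trans ?_ hnum)) _
          have : (0 : ℝ) ≤ 2 * A := by linarith
          gcongr
      _ ≤ _ := mul_le_mul_right b2 _
  refine (sub_nonneg.2 hHG).trans ?_
  rw [← integral_sub hGi hHi]
  have hint : Integrable (fun u => radialKernel f B lam x i j u *
      (∑ k ∈ B, u k - (∑ _k ∈ B, α + 1))) (gammaPi fun _ : ι => α) := by
    have h1 : Integrable (fun u => ∑ k ∈ B, u k * radialKernel f B lam x i j u)
        (gammaPi fun _ : ι => α) := integrable_finsetSum _ fun k _ =>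
          integrable_mul_radialKernel (p := fun _ => α) hlamB hi k
    refine (h1.sub (hK.const_mul (∑ _k ∈ B, α + 1))).congr (ae_of_all _ fun u => ?_)
    simp only [Pi.sub_apply]
    rw [← Finset.sum_mul]
    ring
  refine integral_mono_ae (hGi.sub hHi) hint ?_
  filter_upwards [gammaPi_ae_pos] with u hu
  have hLpos := sum_mul_pos hlamB hi hu
  have hKnn := radialKernel_nonneg (f := f) (x := x) (j := j) hlamB hi hu
  have hR : ∑ k ∈ B, lam k * u k ≤ ∑ k ∈ B, u k := Finset.sum_le_sum fun k _ => by
    nlinarith [hlam1 k, hu k]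
  have hsum : ∑ _k ∈ B, α + 1 ≤ A := by simpa using hA
  simp only [hG, hH]
  by_cases h : 2 * A ≤ ∑ k ∈ B, lam k * u k
  · rw [if_pos h, if_neg (not_lt.2 h), sub_zero]
    have e : u i * u j * f.η (x - ∑ k, lam k * u k) =
        radialKernel f B lam x i j u * ∑ k ∈ B, lam k * u k := by
      rw [radialKernel]; field_simp
    rw [e]
    have : 1 / 2 * ∑ k ∈ B, lam k * u k ≤ ∑ k ∈ B, u k - (∑ _k ∈ B, α + 1) := by linarith
    nlinarith [mul_le_mul_of_nonneg_left this hKnn]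
  · rw [if_neg h, if_pos (not_le.1 h), zero_sub]
    have : -A ≤ ∑ k ∈ B, u k - (∑ _k ∈ B, α + 1) := by linarith
    nlinarith [mul_le_mul_of_nonneg_left this hKnn]

end

/-- Beyond a threshold depending only on the shape and the total weight, the radial integral is
nonnegative, uniformly in the number of coordinates. -/
theorem exists_integral_radialKernel_nonneg {α : ℝ} [hα : Fact (0 < α)] (hα2 : 1 / 2 ≤ α) {M : ℝ}
    (hM0 : 0 ≤ M) :
    ∃ x₀ : ℝ, ∀ (n : ℕ) (lam : Fin n → ℝ) (o i j : Fin n), o ≠ i → o ≠ j → i ≠ j → lam o = 1 →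
      (∀ k, 0 ≤ lam k) → (∀ k, lam k ≤ 1) → ∑ k, lam k ≤ M → 0 < lam i → 0 < lam j →
      (∀ k, lam k ≤ lam i ∨ lam k = 1) → ∀ x ≥ x₀, ∀ f : SmoothStep,
      ∃ B : Finset (Fin n), i ∈ B ∧ j ∈ B ∧ (∀ k ∈ B, 0 < lam k) ∧
      0 ≤ ∫ u, radialKernel f B lam x i j u * (∑ k ∈ B, u k - (∑ _k ∈ B, α + 1))
        ∂gammaPi (fun _ : Fin n => α) := by
  have hα0 := hα.out
  have hΓ := Real.Gamma_pos_of_pos hα0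
  have hc := gammaMeasure_real_Icc_pos (α := α)
  set c := (gammaMeasure α 1).real (Icc 1 2)
  -- At most 32 M weights of total at most M can reach 1/32; the 2 accounts for i and j.
  set N := ⌈32 * M + 2⌉₊ with hN
  set A : ℝ := N * α + 1 with hA
  have hA1 : 1 ≤ A := by rw [hA]; nlinarith [Nat.cast_nonneg (α := ℝ) N]
  obtain ⟨x₀, hx₀⟩ := exists_exp_mul_rpow_le (β := α + 1) (by linarith) (1 + 2 * A + 2 * α * M)
    (K := A * (α * ((2 * A) ^ (2 * α - 1) / (α * Real.Gamma α ^ 2))))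
    (c := 1 / 2 * (c ^ N / 2 * (1 / Real.Gamma α))) (by positivity) (by positivity)
  refine ⟨max x₀ (2 * A + 2 * M + 2 * α * M + 2), fun n lam o i j hoi hoj hij hlamo hlam0 hlam1
    hM hi hj hmax x hx f => ?_⟩
  set B : Finset (Fin n) := insert i (insert j (Finset.univ.filter fun k => 1 / 32 ≤ lam k))
    with hB
  have hB0 : ∀ k ∈ B, 0 < lam k := by
    intro k hk
    simp only [hB, Finset.mem_insert, Finset.mem_filter, Finset.mem_univ, true_and] at hk
    rcases hk with rfl | rfl | hk
    · exact hi
    · exact hj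
    · linarith
  have hcard : B.card ≤ N := by
    have h1 : ((Finset.univ.filter fun k => 1 / 32 ≤ lam k).card : ℝ) * (1 / 32) ≤ M := by
      rw [← nsmul_eq_mul]
      refine (Finset.card_nsmul_le_sum _ _ _ fun _ hk => (Finset.mem_filter.1 hk).2).trans ?_
      exact (Finset.sum_le_sum_of_subset_of_nonneg (Finset.subset_univ _)
        fun _ _ _ => hlam0 _).trans hM
    have h2 : B.card ≤ (Finset.univ.filter fun k => 1 / 32 ≤ lam k).card + 2 := by
      refine (Finset.card_insert_le _ _).trans ?_
      have := Finset.card_insert_le j (Finset.univ.filter fun k => 1 / 32 ≤ lam k)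
      omega
    have h3 : (B.card : ℝ) ≤ 32 * M + 2 := by
      have : (B.card : ℝ) ≤ (Finset.univ.filter fun k => 1 / 32 ≤ lam k).card + 2 := by
        exact_mod_cast h2
      linarith
    exact_mod_cast h3.trans (Nat.le_ceil _)
  refine ⟨B, by simp [hB], by simp [hB], hB0, ?_⟩
  set m := min (lam i) (1 / 32) with hm
  have hm0 : 0 < m := lt_min hi (by norm_num)
  -- Weights outside B are at most m, so θ = 1/(2m) is the largest choice for which this bound
  -- ensures θ λ_k ≤ 1/2.
  refine integral_radialKernel_nonneg_of_le f hα2 (o := o) (θ := 1 / (2 * m)) (A := A) (M := M)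
    ?_ (by simp [hB]) (by simp [hB]) hoi hoj hij hB0 hlam0 hlam1 hlamo hM (by positivity) ?_ ?_
    ((le_max_right _ _).trans hx) ?_
  · simp only [hB, Finset.mem_insert, Finset.mem_filter, Finset.mem_univ, true_and, hlamo]
    norm_num
  · intro k hk
    simp only [hB, Finset.mem_insert, Finset.mem_filter, Finset.mem_univ, true_and, not_or,
      not_le] at hk
    -- Weights equal to 1 exceed 1/32 and therefore belong to B.
    have hk1 : lam k ≤ lam i := (hmax k).resolve_right (by linarith [hk.2.2])
    have hk2 : lam k ≤ m := le_min hk1 hk.2.2.le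
    rw [div_mul_eq_mul_div, one_mul, div_le_div_iff₀ (by positivity) (by norm_num)]
    linarith
  · rw [hA]
    gcongr
  · have h := hx₀ x ((le_max_left _ _).trans hx) (lam i) hi
    have e : 2 * (1 / (2 * m)) * α * M - 1 / (2 * m) * (x - 1 - 2 * A) =
        -(1 / (2 * m) * (x - (1 + 2 * A + 2 * α * M))) := by ring
    rw [e]
    calc _ = A * (α * ((2 * A) ^ (2 * α - 1) / (α * Real.Gamma α ^ 2))) *
          (Real.exp (-(1 / (2 * m) * (x - (1 + 2 * A + 2 * α * M)))) * lam i ^ (-(α + 1))) := by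
          ring
      _ ≤ _ := h
      _ = 1 / 2 * (c ^ N / 2 * (Real.exp (-(2 * x)) / Real.Gamma α)) := by ring
      _ ≤ _ := by
          have : c ^ N ≤ c ^ B.card :=
            pow_le_pow_of_le_one measureReal_nonneg measureReal_le_one hcard
          gcongr

/-! ### From smoothed tails to tails -/

namespace SmoothStep

theorem exists_bound_of_eq_zero {g : ℝ → ℝ} (hg : Continuous g)
    (h0 : ∀ y ∉ Icc (0 : ℝ) 1, g y = 0) : ∃ C, ∀ y, |g y| ≤ C := by
  obtain ⟨C, hC⟩ := isCompact_Icc.exists_bound_of_continuousOn (s := Icc (0 : ℝ) 1) hg.continuousOn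
  refine ⟨C, fun y => ?_⟩
  by_cases hy : y ∈ Icc (0 : ℝ) 1
  · exact hC y hy
  · rw [h0 y hy, abs_zero]
    exact (norm_nonneg _).trans (hC 0 (by simp))

theorem deriv_smoothTransition_eq_zero {y : ℝ} (hy : y ∉ Icc (0 : ℝ) 1) :
    deriv Real.smoothTransition y = 0 := by
  rw [mem_Icc, not_and_or, not_le, not_le] at hy
  rcases hy with hy | hy
  · have : Real.smoothTransition =ᶠ[𝓝 y] fun _ => 0 := by
      filter_upwards [Iio_mem_nhds hy] with z hz
      exact Real.smoothTransition.zero_of_nonpos (le_of_lt hz)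
    rw [this.deriv_eq, deriv_const]
  · have : Real.smoothTransition =ᶠ[𝓝 y] fun _ => 1 := by
      filter_upwards [Ioi_mem_nhds hy] with z hz
      exact Real.smoothTransition.one_of_one_le (le_of_lt hz)
    rw [this.deriv_eq, deriv_const]

theorem deriv_deriv_smoothTransition_eq_zero {y : ℝ} (hy : y ∉ Icc (0 : ℝ) 1) :
    deriv (deriv Real.smoothTransition) y = 0 := by
  have : deriv Real.smoothTransition =ᶠ[𝓝 y] fun _ => 0 := by
    filter_upwards [isClosed_Icc.isOpen_compl.mem_nhds hy] with z hz
    exact deriv_smoothTransition_eq_zero hz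
  rw [this.deriv_eq, deriv_const]

/-- Steps of arbitrarily small width. -/
theorem exists_step {c : ℝ} (hc : 1 ≤ c) :
    ∃ f : SmoothStep, ∀ y, f.φ y = 1 - Real.smoothTransition (c * y) := by
  have hs2 : ContDiff ℝ 2 Real.smoothTransition :=
    Real.smoothTransition.contDiff (n := (2 : ℕ∞))
  have hd : ContDiff ℝ 1 (deriv Real.smoothTransition) := by
    have : ContDiff ℝ (1 + 1) Real.smoothTransition := by
      rw [one_add_one_eq_two]
      exact hs2
    exact (contDiff_succ_iff_deriv.1 this).2.2
  have hdd : Continuous (deriv (deriv Real.smoothTransition)) := hd.continuous_deriv le_rfl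
  obtain ⟨C1, hC1⟩ := exists_bound_of_eq_zero hd.continuous fun y hy =>
    deriv_smoothTransition_eq_zero hy
  obtain ⟨C2, hC2⟩ := exists_bound_of_eq_zero hdd fun y hy =>
    deriv_deriv_smoothTransition_eq_zero hy
  have hc0 : 0 < c := by linarith
  have h1 : ∀ y, HasDerivAt (fun y => Real.smoothTransition (c * y))
      (c * deriv Real.smoothTransition (c * y)) y := by
    intro y
    have := ((hs2.differentiable (by norm_num) (c * y)).hasDerivAt).comp y
      ((hasDerivAt_id y).const_mul c)
    refine this.congr_deriv (by ring)
  have h2 : ∀ y, HasDerivAt (fun y => c * deriv Real.smoothTransition (c * y))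
      (c * (c * deriv (deriv Real.smoothTransition) (c * y))) y := by
    intro y
    have := (((hd.differentiable (by norm_num) (c * y)).hasDerivAt).comp y
      ((hasDerivAt_id y).const_mul c)).const_mul c
    refine this.congr_deriv (by ring)
  refine ⟨{ φ := fun y => 1 - Real.smoothTransition (c * y)
            η := fun y => c * deriv Real.smoothTransition (c * y)
            η' := fun y => c * (c * deriv (deriv Real.smoothTransition) (c * y))
            C := max (c * C1) (c * (c * C2))
            hasDerivAt_φ := fun y => (h1 y).const_sub 1
            hasDerivAt_η := h2
            continuous_η' := by fun_prop
            abs_φ_le := fun y => ?_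
            η_nonneg := fun y => ?_
            η_eq_zero := fun y hy => ?_
            η_le := fun y => ?_
            abs_η'_le := fun y => ?_ }, fun y => rfl⟩
  · have := Real.smoothTransition.nonneg (c * y)
    have := Real.smoothTransition.le_one (c * y)
    rw [abs_le]
    constructor <;> linarith
  · exact mul_nonneg hc0.le Real.smoothTransition.monotone.deriv_nonneg
  · rw [deriv_smoothTransition_eq_zero, mul_zero]
    intro h
    refine hy ⟨?_, ?_⟩
    · exact nonneg_of_mul_nonneg_right h.1 hc0
    · by_contra hlt
      nlinarith [h.2]
  · refine le_trans ?_ (le_max_left _ _)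
    exact mul_le_mul_of_nonneg_left ((le_abs_self _).trans (hC1 _)) hc0.le
  · refine le_trans ?_ (le_max_right _ _)
    rw [abs_mul, abs_mul, abs_of_pos hc0]
    exact mul_le_mul_of_nonneg_left (mul_le_mul_of_nonneg_left (hC2 _) hc0.le) hc0.le

end SmoothStep

/-- The rescaled step equals 1 for S ≥ x and is eventually 0 for S < x, so dominated convergence
yields the closed tail exactly. -/
theorem tendsto_integral_step {Ω : Type*} [MeasurableSpace Ω] {P : Measure Ω}
    [IsProbabilityMeasure P] {S : Ω → ℝ} (hS : Measurable S) (x : ℝ) :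
    Tendsto (fun n : ℕ => ∫ ω, (1 - Real.smoothTransition ((n + 1 : ℝ) * (x - S ω))) ∂P) atTop
      (𝓝 (P.real {ω | x ≤ S ω})) := by
  have hc := Real.smoothTransition.continuous.measurable
  rw [← integral_indicator_one (measurableSet_le measurable_const hS)]
  refine tendsto_integral_of_dominated_convergence (fun _ => 1) (fun n => ?_)
    (integrable_const _) (fun n => ae_of_all _ fun ω => ?_) (ae_of_all _ fun ω => ?_)
  · exact (measurable_const.sub (hc.comp (by fun_prop))).aestronglyMeasurable
  · have := Real.smoothTransition.nonneg ((n + 1 : ℝ) * (x - S ω))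
    have := Real.smoothTransition.le_one ((n + 1 : ℝ) * (x - S ω))
    rw [Real.norm_eq_abs, abs_le]
    constructor <;> linarith
  · by_cases hω : x ≤ S ω
    · rw [indicator_of_mem (show ω ∈ {ω | x ≤ S ω} from hω)]
      refine tendsto_const_nhds.congr fun n => ?_
      rw [Real.smoothTransition.zero_of_nonpos]
      · simp
      · exact mul_nonpos_of_nonneg_of_nonpos (by positivity) (by linarith)
    · rw [indicator_of_notMem (show ω ∉ {ω | x ≤ S ω} from hω)]
      have hpos : 0 < x - S ω := by linarith [not_le.1 hω]
      obtain ⟨N, hN⟩ := exists_nat_gt (1 / (x - S ω))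
      refine tendsto_const_nhds.congr' ?_
      filter_upwards [eventually_ge_atTop N] with n hn
      rw [Real.smoothTransition.one_of_one_le, sub_self]
      rw [div_lt_iff₀ hpos] at hN
      have : (N : ℝ) ≤ n := by exact_mod_cast hn
      nlinarith

/-- Comparison of smoothed tails implies comparison of tails. -/
theorem measureReal_le_of_integral_φ_le {Ω Ω' : Type*} [MeasurableSpace Ω] [MeasurableSpace Ω']
    {P : Measure Ω} {P' : Measure Ω'} [IsProbabilityMeasure P] [IsProbabilityMeasure P']
    {S : Ω → ℝ} {S' : Ω' → ℝ} (hS : Measurable S) (hS' : Measurable S') {x : ℝ}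
    (h : ∀ f : SmoothStep, ∫ ω, f.φ (x - S ω) ∂P ≤ ∫ ω, f.φ (x - S' ω) ∂P') :
    P.real {ω | x ≤ S ω} ≤ P'.real {ω | x ≤ S' ω} := by
  refine le_of_tendsto_of_tendsto' (tendsto_integral_step hS x)
    (tendsto_integral_step hS' x) fun n => ?_
  obtain ⟨f, hf⟩ := SmoothStep.exists_step (c := (n + 1 : ℝ)) (by
    have := Nat.cast_nonneg (α := ℝ) n
    linarith)
  simpa only [hf] using h f

/-! ### Reduction to at most one fractional weight -/

section Majorisation

variable {α : ℝ} [hα : Fact (0 < α)]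

/-- The tail probability of the weighted sum `∑ k, lam k * u k` of gamma variables. -/
noncomputable def gammaTail {ι : Type*} [Fintype ι] (p lam : ι → ℝ) (x : ℝ) : ℝ :=
  (gammaPi p).real {u | x ≤ ∑ k, lam k * u k}

/-- The admissible weights: in `[0, 1]`, with some weight equal to one and total weight `M`. -/
structure IsWeight {n : ℕ} (lam : Fin n → ℝ) (M : ℝ) : Prop where
  nonneg : ∀ k, 0 ≤ lam k
  le_one : ∀ k, lam k ≤ 1
  exists_one : ∃ o, lam o = 1
  sum_eq : ∑ k, lam k = M

/-- The set of indices whose weight lies strictly between zero and one. -/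
noncomputable def fractionalIndices {n : ℕ} (lam : Fin n → ℝ) : Finset (Fin n) :=
  Finset.univ.filter fun k => 0 < lam k ∧ lam k < 1

theorem mem_fractionalIndices {n : ℕ} {lam : Fin n → ℝ} {k : Fin n} :
    k ∈ fractionalIndices lam ↔ 0 < lam k ∧ lam k < 1 := by simp [fractionalIndices]

/-- One majorisation step strictly reduces the number of fractional weights and increases the
tail beyond a uniform threshold. -/
theorem exists_gammaTail_step (hα2 : 1 / 2 ≤ α) {M : ℝ} (hM0 : 0 ≤ M) :
    ∃ x₀ : ℝ, ∀ (n : ℕ) (lam : Fin n → ℝ), IsWeight lam M → 1 < (fractionalIndices lam).card →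
      ∃ lam' : Fin n → ℝ, IsWeight lam' M ∧ (fractionalIndices lam').card < (fractionalIndices lam).card ∧
        ∀ x ≥ x₀, gammaTail (fun _ => α) lam x ≤ gammaTail (fun _ => α) lam' x := by
  have hα0 := hα.out
  obtain ⟨x₀, hx₀⟩ := exists_integral_radialKernel_nonneg (α := α) hα2 hM0
  refine ⟨x₀, fun n lam hlam hcard => ?_⟩
  -- The receiver is the largest fractional weight, so along the whole path every other weight is at
  -- most λ_i or equal to 1; the uniform threshold requires this.
  obtain ⟨i, hi, himax⟩ := Finset.exists_max_image (fractionalIndices lam) lam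
    (Finset.card_pos.1 (by omega))
  obtain ⟨j, hj, hji⟩ := Finset.exists_mem_ne hcard i
  obtain ⟨o, ho⟩ := hlam.exists_one
  rw [mem_fractionalIndices] at hi hj
  have hij : i ≠ j := hji.symm
  have hoi : o ≠ i := by rintro rfl; linarith [hi.2]
  have hoj : o ≠ j := by rintro rfl; linarith [hj.2]
  -- The transfer stops when λ_i reaches 1 or λ_j reaches 0. Path time is scaled by the shape, so
  -- this happens at time α D.
  set D := min (1 - lam i) (lam j) with hD
  have hD0 : 0 < D := lt_min (by linarith [hi.2]) hj.1
  have hD1 : D ≤ 1 - lam i := min_le_left _ _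
  have hD2 : D ≤ lam j := min_le_right _ _
  have hji' : lam j ≤ lam i := himax j (mem_fractionalIndices.2 hj)
  set path := transferPath (fun _ : Fin n => α) lam i j with hpath
  have pi' : ∀ t, path t i = lam i + t / α := transferPath_left _ _ hij
  have pj' : ∀ t, path t j = lam j - t / α := transferPath_right _ _ hij
  have pk' : ∀ t k, k ≠ i → k ≠ j → path t k = lam k := fun t k h1 h2 =>
    transferPath_of_ne _ _ h1 h2 t
  have hsum : ∀ t, ∑ k, path t k = M := by
    intro t
    simp only [hpath, transferPath, Finset.sum_add_distrib, ← Finset.mul_sum, Pi.sub_apply,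
      Finset.sum_sub_distrib, Finset.sum_pi_single', Finset.mem_univ, if_true, sub_self, mul_zero,
      add_zero]
    exact hlam.sum_eq
  have hcases : ∀ (Q : Fin n → Prop), Q i → Q j → (∀ k, k ≠ i → k ≠ j → Q k) → ∀ k, Q k := by
    intro Q h1 h2 h3 k
    by_cases hki : k = i
    · rwa [hki]
    · by_cases hkj : k = j
      · rwa [hkj]
      · exact h3 k hki hkj
  have hnonneg : ∀ t ∈ Icc 0 (α * D), ∀ k, 0 ≤ path t k := by
    intro t ht
    have ht1 : t / α ≤ D := by rw [div_le_iff₀' hα0]; exact ht.2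
    have ht0 : 0 ≤ t / α := div_nonneg ht.1 hα0.le
    refine hcases _ ?_ ?_ fun k h1 h2 => ?_
    · rw [pi']; linarith [hi.1]
    · rw [pj']; linarith
    · rw [pk' t k h1 h2]; exact hlam.nonneg k
  have hleone : ∀ t ∈ Icc 0 (α * D), ∀ k, path t k ≤ 1 := by
    intro t ht
    have ht1 : t / α ≤ D := by rw [div_le_iff₀' hα0]; exact ht.2
    have ht0 : 0 ≤ t / α := div_nonneg ht.1 hα0.le
    refine hcases _ ?_ ?_ fun k h1 h2 => ?_
    · rw [pi']; linarith
    · rw [pj']; linarith [hj.2]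
    · rw [pk' t k h1 h2]; exact hlam.le_one k
  have hpo : ∀ t, path t o = 1 := fun t => by rw [pk' t o hoi hoj, ho]
  have hend : α * D ∈ Icc 0 (α * D) := right_mem_Icc.2 (by positivity)
  have hdiv : α * D / α = D := by field_simp
  refine ⟨path (α * D), ⟨hnonneg _ hend, hleone _ hend, ⟨o, hpo _⟩, hsum _⟩, ?_, ?_⟩
  · refine Finset.card_lt_card ((Finset.ssubset_iff_of_subset ?_).2 ?_)
    · refine hcases (fun k => k ∈ fractionalIndices (path (α * D)) → k ∈ fractionalIndices lam) (fun _ => ?_)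
        (fun _ => ?_) fun k h1 h2 hk => ?_
      · exact mem_fractionalIndices.2 hi
      · exact mem_fractionalIndices.2 hj
      · rw [mem_fractionalIndices, pk' _ k h1 h2] at hk
        exact mem_fractionalIndices.2 hk
    · rcases min_choice (1 - lam i) (lam j) with h | h
      · refine ⟨i, mem_fractionalIndices.2 hi, fun hk => ?_⟩
        rw [mem_fractionalIndices, pi', hdiv, hD, h] at hk
        linarith [hk.2]
      · refine ⟨j, mem_fractionalIndices.2 hj, fun hk => ?_⟩
        rw [mem_fractionalIndices, pj', hdiv, hD, h] at hk
        linarith [hk.1]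
  · intro x hx
    refine measureReal_le_of_integral_φ_le (by fun_prop) (by fun_prop) fun f => ?_
    refine integral_φ_le_of_transfer (p := fun _ => α) f hij lam x (by positivity) hji'
      fun t ht => ?_
    have ht' := Ioo_subset_Icc_self ht
    have ht1 : t / α < D := by rw [div_lt_iff₀' hα0]; exact ht.2
    have ht0 : 0 < t / α := div_pos ht.1 hα0
    refine hx₀ n (path t) o i j hoi hoj hij (hpo t) (hnonneg t ht') (hleone t ht') (hsum t).le
      ?_ ?_ ?_ x hx f
    · rw [pi']; linarith [hi.1]
    · rw [pj']; linarith
    · refine hcases _ (Or.inl le_rfl) (Or.inl ?_) fun k h1 h2 => ?_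
      · rw [pi', pj']; linarith
      · rw [pi', pk' t k h1 h2]
        by_cases hk : k ∈ fractionalIndices lam
        · left
          linarith [himax k hk]
        · rw [mem_fractionalIndices, not_and_or, not_lt, not_lt] at hk
          rcases hk with hk | hk
          · left
            linarith [hi.1]
          · right
            exact le_antisymm (hlam.le_one k) hk

/-- Every admissible weight is dominated by one with at most one fractional entry. -/
theorem exists_gammaTail_le (hα2 : 1 / 2 ≤ α) {M : ℝ} (hM0 : 0 ≤ M) :
    ∃ x₀ : ℝ, ∀ (n : ℕ) (lam : Fin n → ℝ), IsWeight lam M →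
      ∃ lam' : Fin n → ℝ, IsWeight lam' M ∧ (fractionalIndices lam').card ≤ 1 ∧
        ∀ x ≥ x₀, gammaTail (fun _ => α) lam x ≤ gammaTail (fun _ => α) lam' x := by
  obtain ⟨x₀, hx₀⟩ := exists_gammaTail_step (α := α) hα2 hM0
  refine ⟨x₀, fun n lam hlam => ?_⟩
  -- One threshold serves every transfer, so iterating does not worsen it.
  induction h : (fractionalIndices lam).card using Nat.strong_induction_on generalizing lam with
  | _ c ih =>
    by_cases hc : c ≤ 1
    · exact ⟨lam, hlam, h ▸ hc, fun x _ => le_rfl⟩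
    · obtain ⟨lam₁, h1, h2, h3⟩ := hx₀ n lam hlam (by omega)
      obtain ⟨lam₂, h4, h5, h6⟩ := ih _ (h ▸ h2) lam₁ h1 rfl
      exact ⟨lam₂, h4, h5, fun x hx => (h3 x hx).trans (h6 x hx)⟩

end Majorisation

/-! ### Identification of laws by characteristic functions -/

/-- The characteristic function of the gamma distribution with shape `p` and unit rate. -/
noncomputable def gammaCharFun (p ξ : ℝ) : ℂ := (1 - ξ * Complex.I) ^ (-p : ℂ)

theorem one_sub_mul_I_ne_zero (ξ : ℝ) : (1 - ξ * Complex.I : ℂ) ≠ 0 := by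
  intro h
  simpa using congrArg Complex.re h

theorem gammaCharFun_zero (p : ℝ) : gammaCharFun p 0 = 1 := by simp [gammaCharFun]

theorem gammaCharFun_add (p q ξ : ℝ) :
    gammaCharFun (p + q) ξ = gammaCharFun p ξ * gammaCharFun q ξ := by
  simp only [gammaCharFun]
  rw [← Complex.cpow_add _ _ (one_sub_mul_I_ne_zero ξ)]
  push_cast
  ring_nf

theorem gammaCharFun_pow (p ξ : ℝ) (m : ℕ) : gammaCharFun p ξ ^ m = gammaCharFun (m * p) ξ := by
  simp only [gammaCharFun]
  rw [← Complex.cpow_nat_mul]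
  push_cast
  ring_nf

/-- A moment generating function equal to `(1 - s) ^ (-p)` for `s < 1` determines the
characteristic function. -/
theorem charFun_map_eq_gammaCharFun {Ω : Type*} [MeasurableSpace Ω] {P : Measure Ω} {X : Ω → ℝ}
    (hX : AEMeasurable X P) {p : ℝ} (h : ∀ s < 1, mgf X P s = (1 - s) ^ (-p)) (ξ : ℝ) :
    charFun (P.map X) ξ = gammaCharFun p ξ := by
  have hsub : Iio 1 ⊆ interior (integrableExpSet X P) := by
    refine interior_maximal (fun s hs => ?_) isOpen_Iio
    change Integrable _ P
    by_contra hc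
    have h1 := h s hs
    rw [mgf_undef hc] at h1
    have : 0 < (1 - s) ^ (-p) := Real.rpow_pos_of_pos (sub_pos.2 hs) _
    linarith
  have h1 : AnalyticOnNhd ℂ (complexMGF X P) {z | z.re < 1} :=
    analyticOnNhd_complexMGF.mono fun z hz => hsub hz
  have h2 : AnalyticOnNhd ℂ (fun z : ℂ => (1 - z) ^ (-p : ℂ)) {z | z.re < 1} := by
    intro z hz
    have hz : z.re < 1 := hz
    refine (analyticAt_const.sub analyticAt_id).cpow analyticAt_const (Or.inl ?_)
    simpa using hz
  have hconn : IsPreconnected {z : ℂ | z.re < 1} :=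
    ((convex_Iio (1 : ℝ)).linear_preimage Complex.reLm).isPreconnected
  -- Identity theorem on the half-plane Re z < 1: both sides agree at real points near 0, and the
  -- characteristic function is the value at iξ.
  have heq := AnalyticOnNhd.eqOn_of_preconnected_of_frequently_eq h1 h2 hconn (z₀ := 0) (by simp) ?_
  · rw [← complexMGF_id_mul_I, complexMGF_id_map hX, heq (by simp)]
    rfl
  · have h_real : ∃ᶠ x : ℝ in 𝓝[≠] 0, complexMGF X P x = (1 - (x : ℂ)) ^ (-p : ℂ) := by
      refine Eventually.frequently ?_
      filter_upwards [nhdsWithin_le_nhds (Iio_mem_nhds (zero_lt_one (α := ℝ)))] with x hx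
      have hx : x < 1 := hx
      rw [complexMGF_ofReal, h x hx, Complex.ofReal_cpow (by linarith)]
      push_cast
      rfl
    have : Tendsto (fun x : ℝ => (x : ℂ)) (𝓝[≠] 0) (𝓝[≠] 0) := by
      refine tendsto_nhdsWithin_iff.2 ⟨?_, ?_⟩
      · exact (Complex.continuous_ofReal.tendsto' 0 0 (by simp)).mono_left nhdsWithin_le_nhds
      · filter_upwards [self_mem_nhdsWithin] with x hx
        simpa using hx
    exact this.frequently h_real

theorem charFun_gammaMeasure_one {p : ℝ} (hp : 0 < p) (ξ : ℝ) :
    charFun (gammaMeasure p 1) ξ = gammaCharFun p ξ := by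
  have h := charFun_map_eq_gammaCharFun (P := gammaMeasure p 1) (X := id) aemeasurable_id
    (fun s hs => integral_exp_mul_gammaMeasure_one hp hs) ξ
  rwa [Measure.map_id] at h

theorem charFun_map_sq_half_gaussianReal (ξ : ℝ) :
    charFun ((gaussianReal 0 1).map fun x => x ^ 2 / 2) ξ = gammaCharFun (1 / 2) ξ := by
  refine charFun_map_eq_gammaCharFun (by fun_prop) (fun s hs => ?_) ξ
  have hs' : 0 < 1 - s := sub_pos.2 hs
  have h := integral_gaussian ((1 - s) / 2)
  rw [mgf, integral_gaussianReal_eq_integral_smul one_ne_zero]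
  calc _ = ∫ x : ℝ, (√(2 * Real.pi))⁻¹ * Real.exp (-((1 - s) / 2) * x ^ 2) := by
        refine integral_congr_ae (ae_of_all _ fun x => ?_)
        simp only [gaussianPDFReal, smul_eq_mul, NNReal.coe_one, mul_one, sub_zero]
        rw [mul_assoc, ← Real.exp_add]
        ring_nf
    _ = _ := by
        rw [integral_const_mul, h, Real.rpow_neg hs'.le, ← Real.sqrt_eq_rpow,
          show Real.pi / ((1 - s) / 2) = 2 * Real.pi / (1 - s) by field_simp,
          Real.sqrt_div (by positivity)]
        have : √(2 * Real.pi) ≠ 0 := by positivity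
        field_simp

theorem charFun_map_const_mul {Ω : Type*} [MeasurableSpace Ω] {P : Measure Ω} {X : Ω → ℝ}
    (hX : AEMeasurable X P) (c ξ : ℝ) :
    charFun (P.map fun ω => c * X ω) ξ = charFun (P.map X) (c * ξ) := by
  rw [charFun_apply_real, charFun_apply_real, integral_map (by fun_prop) (by fun_prop),
    integral_map hX (by fun_prop)]
  push_cast
  refine integral_congr_ae (ae_of_all _ fun ω => ?_)
  simp only
  ring_nf

theorem charFun_map_sum_pi {ι : Type*} [Fintype ι] (ν : ι → Measure ℝ)
    [∀ k, IsProbabilityMeasure (ν k)] {g : ι → ℝ → ℝ} (hg : ∀ k, Measurable (g k)) (ξ : ℝ) :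
    charFun ((Measure.pi ν).map fun u => ∑ k, g k (u k)) ξ = ∏ k, charFun ((ν k).map (g k)) ξ := by
  have h := iIndepFun.charFun_map_fun_sum_eq_prod (P := Measure.pi ν)
    (X := fun k (u : ι → ℝ) => g k (u k))
    (fun k => ((hg k).comp (measurable_pi_apply k)).aemeasurable)
    (iIndepFun_pi fun k => (hg k).aemeasurable)
  rw [h, Finset.prod_apply]
  refine Finset.prod_congr rfl fun k _ => ?_
  rw [← (measurePreserving_eval ν k).map_eq, Measure.map_map (hg k) (by fun_prop)]
  rfl

theorem charFun_map_sum_gammaPi {ι : Type*} [Fintype ι] {p : ι → ℝ} [hp : ∀ k, Fact (0 < p k)]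
    (lam : ι → ℝ) (ξ : ℝ) :
    charFun ((gammaPi p).map fun u => ∑ k, lam k * u k) ξ =
      ∏ k, gammaCharFun (p k) (lam k * ξ) := by
  rw [gammaPi, charFun_map_sum_pi _ (g := fun k s => lam k * s) (fun k => by fun_prop)]
  refine Finset.prod_congr rfl fun k _ => ?_
  rw [charFun_map_const_mul (X := fun s : ℝ => s) (by fun_prop), Measure.map_id',
    charFun_gammaMeasure_one (hp k).out]

/-- Tail probabilities of `∑ k, lam k * u k` are those of any variable with the same
characteristic function. -/
theorem measureReal_eq_gammaTail {ι Ω : Type*} [Fintype ι] [MeasurableSpace Ω] {P : Measure Ω}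
    [IsProbabilityMeasure P] {X : Ω → ℝ} (hX : AEMeasurable X P) {p : ι → ℝ}
    [hp : ∀ k, Fact (0 < p k)] {lam : ι → ℝ}
    (h : ∀ ξ, charFun (P.map X) ξ = ∏ k, gammaCharFun (p k) (lam k * ξ)) (x : ℝ) :
    P.real {ω | x ≤ X ω} = gammaTail p lam x := by
  have := Measure.isProbabilityMeasure_map hX
  have hm : AEMeasurable (fun u : ι → ℝ => ∑ k, lam k * u k) (gammaPi p) :=
    Measurable.aemeasurable (by fun_prop)
  have := Measure.isProbabilityMeasure_map hm
  have heq : P.map X = (gammaPi p).map fun u => ∑ k, lam k * u k := by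
    refine Measure.ext_of_charFun (funext fun ξ => ?_)
    rw [h, charFun_map_sum_gammaPi]
  have h1 : P.real {ω | x ≤ X ω} = (P.map X).real (Ici x) :=
    (map_measureReal_apply_of_aemeasurable hX measurableSet_Ici).symm
  rw [h1, heq, map_measureReal_apply_of_aemeasurable hm measurableSet_Ici]
  rfl

theorem gammaTail_congr {ι ι' : Type*} [Fintype ι] [Fintype ι'] {p : ι → ℝ} {p' : ι' → ℝ}
    [∀ k, Fact (0 < p k)] [∀ k, Fact (0 < p' k)] {lam : ι → ℝ} {lam' : ι' → ℝ}
    (h : ∀ ξ, ∏ k, gammaCharFun (p k) (lam k * ξ) = ∏ k, gammaCharFun (p' k) (lam' k * ξ)) (x : ℝ) :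
    gammaTail p lam x = gammaTail p' lam' x :=
  measureReal_eq_gammaTail (P := gammaPi p) (Measurable.aemeasurable (by fun_prop))
    (fun ξ => by rw [charFun_map_sum_gammaPi, h]) x

/-! ### The law with at most one fractional weight -/

theorem IsWeight.one_le {n : ℕ} {lam : Fin n → ℝ} {M : ℝ} (h : IsWeight lam M) : 1 ≤ M := by
  obtain ⟨o, ho⟩ := h.exists_one
  rw [← h.sum_eq, ← ho]
  exact Finset.single_le_sum (fun k _ => h.nonneg k) (Finset.mem_univ o)

/-- With at most one fractional entry, products over the weights depend only on the total weight. -/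
theorem IsWeight.prod_eq {n : ℕ} {lam : Fin n → ℝ} {M : ℝ} (h : IsWeight lam M)
    (hcard : (fractionalIndices lam).card ≤ 1) {g : ℝ → ℂ} (hg : g 0 = 1) :
    ∏ k, g (lam k) = g 1 ^ ⌊M⌋₊ * g (M - ⌊M⌋₊) := by
  have hcases : ∀ k, lam k = 0 ∨ lam k = 1 ∨ k ∈ fractionalIndices lam := by
    intro k
    rcases (h.nonneg k).eq_or_lt with h0 | h0
    · exact Or.inl h0.symm
    · rcases (h.le_one k).eq_or_lt with h1 | h1
      · exact Or.inr (Or.inl h1)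
      · exact Or.inr (Or.inr (mem_fractionalIndices.2 ⟨h0, h1⟩))
  have hone : ∀ k, lam k = 1 → k ∉ fractionalIndices lam := fun k hk hk' => (mem_fractionalIndices.1 hk').2.ne hk
  have hzero : ∀ k, lam k = 0 → k ∉ fractionalIndices lam := fun k hk hk' => (mem_fractionalIndices.1 hk').1.ne' hk
  set a := (Finset.univ.filter fun k => lam k = 1).card with ha
  have hprod : ∏ k, g (lam k) = g 1 ^ a * ∏ k ∈ fractionalIndices lam, g (lam k) := by
    have : ∀ k, g (lam k) = (if lam k = 1 then g 1 else 1) *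
        (if k ∈ fractionalIndices lam then g (lam k) else 1) := by
      intro k
      rcases hcases k with hk | hk | hk
      · rw [if_neg (hzero k hk), hk, hg]; simp
      · rw [if_neg (hone k hk), hk]; simp
      · rw [if_pos hk, if_neg fun h1 => hone k h1 hk, one_mul]
    rw [Finset.prod_congr rfl fun k _ => this k, Finset.prod_mul_distrib, Finset.prod_ite_mem,
      Finset.univ_inter, Finset.prod_ite, Finset.prod_const, Finset.prod_const_one, mul_one]
  have hsum : M = a + ∑ k ∈ fractionalIndices lam, lam k := by
    have : ∀ k, lam k = (if lam k = 1 then 1 else 0) +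
        (if k ∈ fractionalIndices lam then lam k else 0) := by
      intro k
      rcases hcases k with hk | hk | hk
      · rw [if_neg (hzero k hk), hk]; simp
      · rw [if_neg (hone k hk), hk]; simp
      · rw [if_pos hk, if_neg fun h1 => hone k h1 hk, zero_add]
    rw [← h.sum_eq, Finset.sum_congr rfl fun k _ => this k, Finset.sum_add_distrib,
      Finset.sum_ite_mem, Finset.univ_inter, Finset.sum_boole]
  -- Either way the number of ones is ⌊M⌋ and the remainder is M - ⌊M⌋; without a fractional weight
  -- this is 0 and g 0 = 1.
  rcases Nat.le_one_iff_eq_zero_or_eq_one.1 hcard with h0 | h1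
  · rw [Finset.card_eq_zero.1 h0] at hprod hsum
    simp only [Finset.sum_empty, add_zero, Finset.prod_empty, mul_one] at hprod hsum
    rw [hprod, hsum, Nat.floor_natCast, sub_self, hg, mul_one]
  · obtain ⟨i, hi⟩ := Finset.card_eq_one.1 h1
    have hi' := mem_fractionalIndices.1 (hi ▸ Finset.mem_singleton_self i : i ∈ fractionalIndices lam)
    rw [hi] at hprod hsum
    simp only [Finset.sum_singleton, Finset.prod_singleton] at hprod hsum
    have hfl : ⌊M⌋₊ = a := by
      rw [Nat.floor_eq_iff (by linarith [h.one_le])]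
      constructor <;> linarith
    rw [hprod, hfl]
    congr 2
    linarith

section

variable {α : ℝ} [hα : Fact (0 < α)]

theorem IsWeight.prod_gammaCharFun {n : ℕ} {lam : Fin n → ℝ} {M : ℝ} (h : IsWeight lam M)
    (hcard : (fractionalIndices lam).card ≤ 1) (ξ : ℝ) :
    ∏ k, gammaCharFun α (lam k * ξ) =
      gammaCharFun (⌊M⌋₊ * α) ξ * gammaCharFun α ((M - ⌊M⌋₊) * ξ) := by
  rw [h.prod_eq hcard (g := fun s => gammaCharFun α (s * ξ)) (by simp [gammaCharFun_zero]),
    one_mul, gammaCharFun_pow]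

/-- Zero weights contribute trivial factors, so the law depends on M alone and the lengths n and n'
may differ. -/
theorem IsWeight.gammaTail_eq {n n' : ℕ} {lam : Fin n → ℝ} {lam' : Fin n' → ℝ} {M : ℝ}
    (h : IsWeight lam M) (h' : IsWeight lam' M) (hcard : (fractionalIndices lam).card ≤ 1)
    (hcard' : (fractionalIndices lam').card ≤ 1) (x : ℝ) :
    gammaTail (fun _ => α) lam x = gammaTail (fun _ => α) lam' x :=
  gammaTail_congr (fun ξ => by
    rw [h.prod_gammaCharFun hcard, h'.prod_gammaCharFun hcard']) x

/-- Smoothing the fractional weight into a gamma variable increases the upper tail. -/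
theorem IsWeight.gammaTail_le_gammaMeasure {n : ℕ} {lam : Fin n → ℝ} {M : ℝ}
    (h : IsWeight lam M) (hcard : (fractionalIndices lam).card ≤ 1) {x : ℝ} (hx : (M + 1) * α + 2 ≤ x) :
    gammaTail (fun _ => α) lam x ≤ (gammaMeasure (M * α) 1).real (Ici x) := by
  have hα0 := hα.out
  have hM := h.one_le
  have hMα : Fact (0 < M * α) := ⟨by positivity⟩
  have hfl : (1 : ℝ) ≤ ⌊M⌋₊ := by exact_mod_cast (Nat.one_le_floor_iff M).2 hM
  have hfl' : (⌊M⌋₊ : ℝ) ≤ M := Nat.floor_le (by linarith)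
  have hlt : M < ⌊M⌋₊ + 1 := Nat.lt_floor_add_one M
  set f := M - ⌊M⌋₊ with hf
  rcases hfl'.eq_or_lt with he | hl
  · have hf0 : f = 0 := by rw [hf, he, sub_self]
    refine le_of_eq (measureReal_eq_gammaTail (P := gammaMeasure (M * α) 1) (X := id)
      aemeasurable_id (fun ξ => ?_) x).symm
    rw [Measure.map_id, h.prod_gammaCharFun hcard, ← hf, hf0, zero_mul, gammaCharFun_zero, mul_one,
      charFun_gammaMeasure_one hMα.out, he]
  · have hf0 : 0 < f := sub_pos.2 hl
    have hf1 : f < 1 := by rw [hf]; linarith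
    -- The unit weights merge into one gamma variable, and the variable of weight f is split into
    -- independent shapes fα and (1 - f)α.
    set p : Fin 3 → ℝ := ![⌊M⌋₊ * α, f * α, (1 - f) * α] with hp
    have hp0 : ∀ k, Fact (0 < p k) := by
      intro k
      refine ⟨?_⟩
      fin_cases k
      · change 0 < (⌊M⌋₊ : ℝ) * α
        positivity
      · change 0 < f * α
        positivity
      · change 0 < (1 - f) * α
        exact mul_pos (by linarith) hα0
    have h01 : (1 : Fin 3) ≠ 2 := by decide
    have h1 : gammaTail (fun _ => α) lam x = gammaTail p ![1, f, f] x := by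
      refine gammaTail_congr (fun ξ => ?_) x
      rw [h.prod_gammaCharFun hcard, Fin.prod_univ_three]
      change _ = gammaCharFun (⌊M⌋₊ * α) (1 * ξ) * gammaCharFun (f * α) (f * ξ) *
        gammaCharFun ((1 - f) * α) (f * ξ)
      rw [mul_assoc, ← gammaCharFun_add, one_mul]
      congr 2
      ring
    -- At this time the third weight reaches 0 and the second reaches 1 simultaneously, because f·(1
    -- - f)α = (1 - f)·fα.
    set T := f * ((1 - f) * α) with hT
    have hT0 : 0 ≤ T := mul_nonneg hf0.le (mul_nonneg (by linarith) hα0.le)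
    have q0 : ∀ t, transferPath p ![1, f, f] 1 2 t 0 = 1 := fun t =>
      transferPath_of_ne _ _ (by decide) (by decide) t
    have q1 : ∀ t, transferPath p ![1, f, f] 1 2 t 1 = f + t / (f * α) := fun t =>
      transferPath_left _ _ h01 t
    have q2 : ∀ t, transferPath p ![1, f, f] 1 2 t 2 = f - t / ((1 - f) * α) := fun t =>
      transferPath_right _ _ h01 t
    have hpos1 : 0 < f * α := by positivity
    have hpos2 : 0 < (1 - f) * α := mul_pos (by linarith) hα0
    have hT1 : T / (f * α) = 1 - f := by rw [hT]; field_simp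
    have hT2 : T / ((1 - f) * α) = f := by rw [hT]; exact mul_div_cancel_right₀ _ hpos2.ne'
    have h2 : gammaTail p ![1, f, f] x ≤ gammaTail p (transferPath p ![1, f, f] 1 2 T) x := by
      refine measureReal_le_of_integral_φ_le (by fun_prop) (by fun_prop) fun F => ?_
      refine integral_φ_le_of_transfer (p := p) F h01 _ x hT0 (le_refl f) fun t ht => ?_
      have ht1 : t / (f * α) < 1 - f := by
        rw [← hT1]; exact div_lt_div_of_pos_right ht.2 hpos1
      have ht2 : t / ((1 - f) * α) < f := by
        conv_rhs => rw [← hT2]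
        exact div_lt_div_of_pos_right ht.2 hpos2
      have ht1' : 0 < t / (f * α) := div_pos ht.1 hpos1
      have ht2' : 0 < t / ((1 - f) * α) := div_pos ht.1 hpos2
      have hall : ∀ k, 0 < transferPath p ![1, f, f] 1 2 t k ∧
          transferPath p ![1, f, f] 1 2 t k ≤ 1 := by
        intro k
        fin_cases k
        · exact (q0 t).symm ▸ ⟨one_pos, le_rfl⟩
        · exact (q1 t).symm ▸ ⟨by linarith, by linarith⟩
        · exact (q2 t).symm ▸ ⟨by linarith, by linarith⟩
      refine ⟨Finset.univ, Finset.mem_univ _, Finset.mem_univ _, fun k _ => (hall k).1,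
        integral_radialKernel_univ_nonneg F (fun k => (hall k).1) (fun k => (hall k).2) ?_ _ _⟩
      -- The shapes add up to (⌊M⌋ + 1) α, whence the threshold (M + 1) α + 2.
      have : ∑ k, p k = ⌊M⌋₊ * α + f * α + (1 - f) * α := Fin.sum_univ_three p
      rw [this]
      nlinarith
    have h3 : gammaTail p (transferPath p ![1, f, f] 1 2 T) x =
        (gammaMeasure (M * α) 1).real (Ici x) := by
      refine (measureReal_eq_gammaTail (P := gammaMeasure (M * α) 1) (X := id)
        aemeasurable_id (fun ξ => ?_) x).symm
      rw [Measure.map_id, charFun_gammaMeasure_one hMα.out, Fin.prod_univ_three, q0, q1, q2, hT1,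
        hT2, add_sub_cancel, sub_self, zero_mul, gammaCharFun_zero, mul_one, one_mul]
      change _ = gammaCharFun (⌊M⌋₊ * α) ξ * gammaCharFun (f * α) ξ
      rw [← gammaCharFun_add, hf]
      congr 1
      ring
    rw [h1, ← h3]
    exact h2

end

/-! ### The trace estimator as a weighted sum of gamma variables -/

section Gaussian

variable {n m : ℕ} {A : Matrix (Fin n) (Fin n) ℝ} {lam : Fin n → ℝ} {s : ℝ}
  {b : OrthonormalBasis (Fin n) ℝ (EuclideanSpace ℝ (Fin n))}
  {Ω : Type*} [MeasurableSpace Ω] {P : Measure Ω} [IsProbabilityMeasure P]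
  {z : Fin m → Ω → EuclideanSpace ℝ (Fin n)}

/-- Rotation invariance: the coordinates in any orthonormal basis are independent standard normals,
and half the square of each is Gamma(1/2, 1). -/
theorem charFun_map_sum_sq_stdGaussian (b : OrthonormalBasis (Fin n) ℝ (EuclideanSpace ℝ (Fin n)))
    (lam : Fin n → ℝ) (ξ : ℝ) :
    charFun ((stdGaussian (EuclideanSpace ℝ (Fin n))).map
      fun v => ∑ i, lam i * ((b.repr v i) ^ 2 / 2)) ξ = ∏ i, gammaCharFun (1 / 2) (lam i * ξ) := by
  rw [stdGaussian_eq_map_pi_orthonormalBasis b, Measure.map_map (by fun_prop) (by fun_prop)]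
  have : ((fun v => ∑ i, lam i * ((b.repr v i) ^ 2 / 2)) ∘ fun x : Fin n → ℝ => ∑ i, x i • b i) =
      fun x : Fin n → ℝ => ∑ i, lam i * (x i ^ 2 / 2) := by
    funext x
    refine Finset.sum_congr rfl fun i _ => ?_
    change lam i * (b.repr (∑ i, x i • b i) i ^ 2 / 2) = _
    rw [show ∑ i, x i • b i = b.repr.symm (WithLp.toLp 2 x) from b.sum_repr_symm (WithLp.toLp 2 x),
      LinearIsometryEquiv.apply_symm_apply]
  rw [this, charFun_map_sum_pi _ (g := fun i s => lam i * (s ^ 2 / 2)) (fun i => by fun_prop)]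
  refine Finset.prod_congr rfl fun i _ => ?_
  rw [charFun_map_const_mul (X := fun s : ℝ => s ^ 2 / 2) (by fun_prop),
    charFun_map_sq_half_gaussianReal]

theorem IsGaussianSample.aemeasurable (hz : IsGaussianSample P z) (j : Fin m) :
    AEMeasurable (z j) P := (hz.hasLaw j).aemeasurable

/-- The tail of the rescaled trace estimator, for a matrix that is diagonal with entries
`s * lam i` in an orthonormal basis. -/
theorem measureReal_traceEstimator_eq_gammaTail [Fact (0 < (m : ℝ) / 2)]
    (hz : IsGaussianSample P z) (hs : s ≠ 0)
    (hA : ∀ v : EuclideanSpace ℝ (Fin n), dotProduct v.ofLp (A.mulVec v.ofLp) =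
      s * ∑ i, lam i * (b.repr v i) ^ 2) (x : ℝ) :
    P.real {ω | x ≤ m / (2 * s) * traceEstimator A fun j => z j ω} =
      gammaTail (fun _ => (m : ℝ) / 2) lam x := by
  have hm : (m : ℝ) ≠ 0 := by
    have : 0 < (m : ℝ) / 2 := Fact.out
    intro h
    rw [h] at this
    simp at this
  set q : EuclideanSpace ℝ (Fin n) → ℝ := fun v => ∑ i, lam i * ((b.repr v i) ^ 2 / 2) with hq
  have hqm : Measurable q := by fun_prop
  have hqz : ∀ j, AEMeasurable (fun ω => q (z j ω)) P := fun j =>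
    hqm.comp_aemeasurable (hz.aemeasurable j)
  have heq : (fun ω => m / (2 * s) * traceEstimator A fun j => z j ω) =
      fun ω => ∑ j, q (z j ω) := by
    funext ω
    simp only [traceEstimator, hA, hq, mul_div_assoc', ← Finset.sum_div, ← Finset.mul_sum]
    field_simp
  have heq' : {ω | x ≤ m / (2 * s) * traceEstimator A fun j => z j ω} =
      {ω | x ≤ ∑ j, q (z j ω)} := by
    ext ω
    exact iff_of_eq (congrArg (x ≤ ·) (congrFun heq ω))
  rw [heq']
  refine measureReal_eq_gammaTail
    (by simpa using Finset.aemeasurable_fun_sum Finset.univ fun j _ => hqz j) (fun ξ => ?_) x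
  rw [iIndepFun.charFun_map_fun_sum_eq_prod hqz (hz.indep.comp (fun _ => q) fun _ => hqm),
    Finset.prod_apply]
  have hj : ∀ j, charFun (P.map fun ω => q (z j ω)) ξ =
      ∏ i, gammaCharFun (1 / 2) (lam i * ξ) := by
    intro j
    rw [← charFun_map_sum_sq_stdGaussian b lam ξ, ← (hz.hasLaw j).map_eq,
      AEMeasurable.map_map_of_aemeasurable hqm.aemeasurable (hz.aemeasurable j)]
    rfl
  rw [Finset.prod_congr rfl fun j _ => hj j, Finset.prod_const, Finset.card_univ,
    Fintype.card_fin, ← Finset.prod_pow]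
  refine Finset.prod_congr rfl fun i _ => ?_
  -- The m samples add their shapes 1/2, which gives m/2 for each eigenvalue.
  rw [gammaCharFun_pow, mul_one_div]

/-- Beyond relative error one only the upper tail of the trace estimator contributes. -/
theorem measureReal_abs_traceEstimator_sub_eq [Fact (0 < (m : ℝ) / 2)] {M ε : ℝ}
    (hz : IsGaussianSample P z) (hlam : IsWeight lam M) (hs : 0 < s) (hε : 1 < ε)
    (hA : ∀ v : EuclideanSpace ℝ (Fin n), dotProduct v.ofLp (A.mulVec v.ofLp) =
      s * ∑ i, lam i * (b.repr v i) ^ 2) :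
    P.real {ω | |traceEstimator A (fun j => z j ω) - s * M| ≥ ε * (s * M)} =
      gammaTail (fun _ => (m : ℝ) / 2) lam (m / 2 * M * (1 + ε)) := by
  rw [← measureReal_traceEstimator_eq_gammaTail (b := b) hz hs.ne' hA]
  have hm : 0 < (m : ℝ) / 2 := Fact.out
  congr 1
  ext ω
  simp only [ge_iff_le, Set.mem_ofPred_eq]
  set E := traceEstimator A fun j => z j ω
  have hE : 0 ≤ E := by
    refine mul_nonneg (by positivity) (Finset.sum_nonneg fun j _ => ?_)
    rw [hA]
    exact mul_nonneg hs.le (Finset.sum_nonneg fun i _ => mul_nonneg (hlam.nonneg i) (sq_nonneg _))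
  have hsM : 0 < s * M := mul_pos hs (by linarith [hlam.one_le])
  have h1 : m / 2 * M * (1 + ε) ≤ m / (2 * s) * E ↔ s * M * (1 + ε) ≤ E := by
    rw [show (m : ℝ) / (2 * s) * E = m / 2 * (E / s) by field_simp, mul_assoc,
      mul_le_mul_iff_right₀ hm, le_div_iff₀ hs]
    ring_nf
  rw [h1, le_abs]
  constructor
  · rintro (h | h)
    · linarith
    -- A lower deviation with ε > 1 would make the nonnegative estimator negative.
    · nlinarith
  · intro h
    left
    linarith

end Gaussian

/-! ### Eigenvalues, spectral norm and the extremal matrix -/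

section Matrices

variable {n : ℕ} {A : Matrix (Fin n) (Fin n) ℝ}

theorem repr_toEuclideanCLM_eigenvectorBasis (hA : A.IsHermitian) (v : EuclideanSpace ℝ (Fin n))
    (i : Fin n) : hA.eigenvectorBasis.repr (Matrix.toEuclideanCLM (𝕜 := ℝ) A v) i =
      hA.eigenvalues i * hA.eigenvectorBasis.repr v i := by
  have h1 : Matrix.toEuclideanCLM (𝕜 := ℝ) A (hA.eigenvectorBasis i) =
      hA.eigenvalues i • hA.eigenvectorBasis i := by
    ext k
    exact congrFun (hA.mulVec_eigenvectorBasis i) k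
  have h2 := (Matrix.isSymmetric_toEuclideanLin_iff.2 hA) (hA.eigenvectorBasis i) v
  rw [← Matrix.coe_toEuclideanCLM_eq_toEuclideanLin] at h2
  rw [OrthonormalBasis.repr_apply_apply, OrthonormalBasis.repr_apply_apply]
  refine h2.symm.trans ?_
  change inner ℝ (Matrix.toEuclideanCLM (𝕜 := ℝ) A (hA.eigenvectorBasis i)) v = _
  rw [h1, real_inner_smul_left]

theorem dotProduct_mulVec_eq_sum_eigenvalues (hA : A.IsHermitian)
    (v : EuclideanSpace ℝ (Fin n)) : dotProduct v.ofLp (A.mulVec v.ofLp) =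
      ∑ i, hA.eigenvalues i * (hA.eigenvectorBasis.repr v i) ^ 2 := by
  rw [← Matrix.inner_toEuclideanCLM, ← hA.eigenvectorBasis.repr.inner_map_map, PiLp.inner_apply]
  refine Finset.sum_congr rfl fun i _ => ?_
  rw [repr_toEuclideanCLM_eigenvectorBasis]
  simp only [RCLike.inner_apply, conj_trivial]
  ring

theorem abs_eigenvalues_le_specNorm (hA : A.IsHermitian) (i : Fin n) :
    |hA.eigenvalues i| ≤ specNorm A := by
  have h := (Matrix.toEuclideanCLM (n := Fin n) (𝕜 := ℝ) A).le_opNorm (hA.eigenvectorBasis i)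
  have h1 : Matrix.toEuclideanCLM (𝕜 := ℝ) A (hA.eigenvectorBasis i) =
      hA.eigenvalues i • hA.eigenvectorBasis i := by
    ext k
    exact congrFun (hA.mulVec_eigenvectorBasis i) k
  rwa [h1, norm_smul, hA.eigenvectorBasis.norm_eq_one, mul_one, mul_one, Real.norm_eq_abs] at h

theorem specNorm_le_of_eigenvalues (hA : A.IsHermitian) {C : ℝ} (hC : 0 ≤ C)
    (h : ∀ i, |hA.eigenvalues i| ≤ C) : specNorm A ≤ C := by
  refine ContinuousLinearMap.opNorm_le_bound _ hC fun v => ?_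
  refine (sq_le_sq₀ (norm_nonneg _) (by positivity)).1 ?_
  rw [← hA.eigenvectorBasis.repr.norm_map, ← hA.eigenvectorBasis.repr.norm_map v, mul_pow,
    EuclideanSpace.real_norm_sq_eq, EuclideanSpace.real_norm_sq_eq, Finset.mul_sum]
  refine Finset.sum_le_sum fun i _ => ?_
  rw [repr_toEuclideanCLM_eigenvectorBasis, mul_pow]
  have := sq_le_sq' (by linarith [neg_abs_le (hA.eigenvalues i), h i])
    ((le_abs_self _).trans (h i))
  gcongr

theorem specNorm_pos (hA : A ≠ 0) : 0 < specNorm A := by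
  refine norm_pos_iff.2 fun h => hA ?_
  exact (Matrix.toEuclideanCLM (n := Fin n) (𝕜 := ℝ)).injective (h.trans (map_zero _).symm)

/-- The eigenvalues of a nonzero positive semidefinite matrix, divided by its spectral norm. -/
theorem isWeight_eigenvalues (hA : A.PosSemidef) (h0 : A ≠ 0) :
    IsWeight (fun i => hA.isHermitian.eigenvalues i / specNorm A) (effectiveRank A) := by
  have hpos := specNorm_pos h0
  refine ⟨fun i => div_nonneg (hA.eigenvalues_nonneg i) hpos.le, fun i => ?_, ?_, ?_⟩
  · rw [div_le_one hpos]
    exact (le_abs_self _).trans (abs_eigenvalues_le_specNorm hA.isHermitian i)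
  · have hne : Nonempty (Fin n) := by
      by_contra h
      rw [not_nonempty_iff] at h
      exact h0 (Subsingleton.elim _ _)
    obtain ⟨o, ho⟩ := Finite.exists_max hA.isHermitian.eigenvalues
    refine ⟨o, (div_eq_one_iff_eq hpos.ne').2 (le_antisymm ?_ ?_)⟩
    · exact (le_abs_self _).trans (abs_eigenvalues_le_specNorm hA.isHermitian o)
    · refine specNorm_le_of_eigenvalues hA.isHermitian (hA.eigenvalues_nonneg o) fun i => ?_
      rw [abs_of_nonneg (hA.eigenvalues_nonneg i)]
      exact ho i
  · rw [← Finset.sum_div, effectiveRank, hA.isHermitian.trace_eq_sum_eigenvalues]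
    rfl

/-- The diagonal of `μ • extremalMatrix N μ`. -/
noncomputable def extremalWeight (N : ℕ) (μ : ℝ) (i : Fin N) : ℝ :=
  if (i : ℕ) < ⌊μ⌋₊ then 1 else if (i : ℕ) = ⌊μ⌋₊ then μ - (⌊μ⌋₊ : ℝ) else 0

theorem isWeight_extremalWeight {N : ℕ} {μ : ℝ} (hμ : 1 ≤ μ) (hN : μ ≤ N) :
    IsWeight (extremalWeight N μ) μ := by
  have hfl : 0 < ⌊μ⌋₊ := Nat.floor_pos.2 hμ
  have hfl' : (⌊μ⌋₊ : ℝ) ≤ μ := Nat.floor_le (by linarith)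
  have hlt : μ < ⌊μ⌋₊ + 1 := Nat.lt_floor_add_one μ
  have hflN : ⌊μ⌋₊ ≤ N := by exact_mod_cast hfl'.trans hN
  refine ⟨fun k => ?_, fun k => ?_, ⟨⟨0, hfl.trans_le hflN⟩, ?_⟩, ?_⟩
  · unfold extremalWeight
    split_ifs <;> linarith
  · unfold extremalWeight
    split_ifs <;> linarith
  · simp [extremalWeight, hfl]
  · have h1 : ∀ N, ⌊μ⌋₊ ≤ N → ∑ i ∈ Finset.range N, (if i < ⌊μ⌋₊ then (1 : ℝ) else 0) = ⌊μ⌋₊ := by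
      intro N hN
      rw [Finset.sum_boole]
      congr 1
      rw [show Finset.filter (· < ⌊μ⌋₊) (Finset.range N) = Finset.range ⌊μ⌋₊ by
        ext i; simp; omega, Finset.card_range]
    have h2 : ∑ i ∈ Finset.range N, (if i = ⌊μ⌋₊ then μ - (⌊μ⌋₊ : ℝ) else 0) = μ - ⌊μ⌋₊ := by
      rw [Finset.sum_ite_eq']
      split_ifs with h
      · rfl
      -- If there is no room for the fractional entry, then N ≤ ⌊μ⌋; together with μ ≤ N this forces
      -- μ = ⌊μ⌋, and the missing entry is 0.
      · rw [Finset.mem_range, not_lt] at h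
        have : (N : ℝ) ≤ ⌊μ⌋₊ := by exact_mod_cast h
        linarith
    have h3 : ∀ i : ℕ, (if i < ⌊μ⌋₊ then 1 else if i = ⌊μ⌋₊ then μ - (⌊μ⌋₊ : ℝ) else 0) =
        (if i < ⌊μ⌋₊ then (1 : ℝ) else 0) + (if i = ⌊μ⌋₊ then μ - (⌊μ⌋₊ : ℝ) else 0) := by
      intro i
      by_cases h : i < ⌊μ⌋₊
      · simp [h, h.ne]
      · simp [h]
    unfold extremalWeight
    rw [Fin.sum_univ_eq_sum_range (fun i : ℕ =>
      if i < ⌊μ⌋₊ then 1 else if i = ⌊μ⌋₊ then μ - (⌊μ⌋₊ : ℝ) else 0),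
      Finset.sum_congr rfl fun i _ => h3 i, Finset.sum_add_distrib, h1 N hflN, h2]
    ring

theorem card_fractionalIndices_extremalWeight_le (N : ℕ) (μ : ℝ) :
    (fractionalIndices (extremalWeight N μ)).card ≤ 1 := by
  have h : ∀ k ∈ fractionalIndices (extremalWeight N μ), (k : ℕ) = ⌊μ⌋₊ := by
    intro k hk
    rw [mem_fractionalIndices] at hk
    unfold extremalWeight at hk
    by_contra hne
    rw [if_neg hne] at hk
    split_ifs at hk
    · exact lt_irrefl _ hk.2
    · exact lt_irrefl _ hk.1
  exact Finset.card_le_one.2 fun a ha b hb => Fin.ext ((h a ha).trans (h b hb).symm)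

theorem dotProduct_extremalMatrix_mulVec (N : ℕ) (μ : ℝ) (v : EuclideanSpace ℝ (Fin N)) :
    dotProduct v.ofLp ((extremalMatrix N μ).mulVec v.ofLp) =
      1 / μ * ∑ i, extremalWeight N μ i *
        ((EuclideanSpace.basisFun (Fin N) ℝ).repr v i) ^ 2 := by
  rw [extremalMatrix, Matrix.smul_mulVec, dotProduct_smul, smul_eq_mul]
  congr 1
  refine Finset.sum_congr rfl fun i _ => ?_
  rw [Matrix.mulVec_diagonal, EuclideanSpace.basisFun_repr, extremalWeight]
  ring

end Matrices

/-! ### Change of rate and conclusion -/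

theorem measureReal_gammaMeasure_Ici {a r : ℝ} (ha : 0 < a) (hr : 0 < r) (y : ℝ) :
    (gammaMeasure a r).real (Ici y) = ∫ u in Ioi y, gammaPDFReal a r u := by
  rw [Measure.real, gammaMeasure, withDensity_apply _ measurableSet_Ici,
    ← integral_Ici_eq_integral_Ioi, integral_eq_lintegral_of_nonneg_ae]
  · rfl
  · exact ae_of_all _ fun u => gammaPDFReal_nonneg ha hr u
  · exact (measurable_gammaPDFReal a r).aestronglyMeasurable

theorem measureReal_gammaMeasure_Ici_eq {a r : ℝ} (ha : 0 < a) (hr : 0 < r) {y : ℝ} (hy : 0 ≤ y) :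
    (gammaMeasure a r).real (Ici y) = (gammaMeasure a 1).real (Ici (r * y)) := by
  rw [measureReal_gammaMeasure_Ici ha hr, measureReal_gammaMeasure_Ici ha one_pos]
  have h := integral_comp_mul_left_Ioi (gammaPDFReal a 1) y hr
  rw [smul_eq_mul, eq_inv_mul_iff_mul_eq₀ hr.ne', ← integral_const_mul] at h
  rw [← h]
  refine setIntegral_congr_fun measurableSet_Ioi fun u hu => ?_
  have hu0 : 0 < u := hy.trans_lt hu
  simp only [gammaPDFReal, if_pos hu0.le, if_pos (mul_pos hr hu0).le, Real.one_rpow, one_mul]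
  rw [Real.mul_rpow hr.le hu0.le, Real.rpow_sub_one hr.ne']
  field_simp

theorem gammaMeasure_one_le_of_hasLaw {Ω : Type*} [MeasurableSpace Ω] {P : Measure Ω}
    [IsProbabilityMeasure P] {X : Ω → ℝ} {a : ℝ} (ha : 0 < a) (hX : HasLaw X (gammaMeasure a a) P)
    {ε : ℝ} (hε : 0 ≤ ε) :
    (gammaMeasure a 1).real (Ici (a * (1 + ε))) ≤ P.real {ω | |X ω - 1| ≥ ε} := by
  rw [← measureReal_gammaMeasure_Ici_eq ha ha (by linarith), ← hX.map_eq,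
    map_measureReal_apply_of_aemeasurable hX.aemeasurable measurableSet_Ici]
  refine measureReal_mono fun ω hω => ?_
  have hω : 1 + ε ≤ X ω := hω
  change ε ≤ |X ω - 1|
  exact le_trans (by linarith) (le_abs_self _)

end

theorem mainTheorem4 (m : ℕ) (hm : 0 < m) (μ : ℝ) :
    ∃ εrel : ℝ, ∀ (n : ℕ) (A : Matrix (Fin n) (Fin n) ℝ),
      A.PosSemidef → A ≠ 0 → effectiveRank A = μ →
      ∀ N : ℕ, μ ≤ (N : ℝ) →
      ∀ {Ω₁ : Type*} [MeasurableSpace Ω₁] (P₁ : Measure Ω₁) [IsProbabilityMeasure P₁]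
        (z : Fin m → Ω₁ → EuclideanSpace ℝ (Fin n)), IsGaussianSample P₁ z →
      ∀ {Ω₂ : Type*} [MeasurableSpace Ω₂] (P₂ : Measure Ω₂) [IsProbabilityMeasure P₂]
        (w : Fin m → Ω₂ → EuclideanSpace ℝ (Fin N)), IsGaussianSample P₂ w →
      ∀ {Ω₃ : Type*} [MeasurableSpace Ω₃] (P₃ : Measure Ω₃) [IsProbabilityMeasure P₃]
        (X : Ω₃ → ℝ), HasLaw X (gammaMeasure (m * μ / 2) (m * μ / 2)) P₃ →
      ∀ ε : ℝ, εrel ≤ ε →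
        P₁.real {ω | |traceEstimator A (fun j => z j ω) - A.trace| ≥ ε * A.trace} ≤
            P₂.real {ω | |traceEstimator (extremalMatrix N μ) (fun j => w j ω) - 1| ≥ ε} ∧
          P₂.real {ω | |traceEstimator (extremalMatrix N μ) (fun j => w j ω) - 1| ≥ ε} ≤
            P₃.real {ω | |X ω - 1| ≥ ε} := by
  by_cases hμ : 1 ≤ μ
  swap
  -- An effective rank is at least 1, so this case is vacuous.
  · exact ⟨0, fun n A hA h0 hr => absurd (hr ▸ (isWeight_eigenvalues hA h0).one_le) hμ⟩
  have hm1 : (1 : ℝ) ≤ m := by exact_mod_cast hm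
  have hα : Fact (0 < (m : ℝ) / 2) := ⟨by positivity⟩
  obtain ⟨x₀, hx₀⟩ := exists_gammaTail_le (α := (m : ℝ) / 2) (by linarith) (M := μ) (by linarith)
  have hαμ : 0 < (m : ℝ) / 2 * μ := mul_pos hα.out (by linarith)
  -- The 2 ensures ε > 1, which removes the lower tails; the other term puts x = (m/2) μ (1 + ε)
  -- beyond the thresholds of both comparisons.
  refine ⟨max 2 (max x₀ ((μ + 1) * (m / 2) + 2) / (m / 2 * μ)),
    fun n A hA h0 hr N hN Ω₁ _ P₁ _ z hz Ω₂ _ P₂ _ w hw Ω₃ _ P₃ _ X hX ε hε => ?_⟩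
  have hε2 : 2 ≤ ε := (le_max_left _ _).trans hε
  have hx : max x₀ ((μ + 1) * (m / 2) + 2) ≤ m / 2 * μ * (1 + ε) := by
    have := (le_max_right _ _).trans hε
    rw [div_le_iff₀ hαμ] at this
    linarith
  have hpos := specNorm_pos h0
  have hwt := isWeight_eigenvalues hA h0
  rw [hr] at hwt
  have htr : A.trace = specNorm A * μ := by
    rw [← hr, effectiveRank, mul_div_cancel₀ _ hpos.ne']
  have hext := isWeight_extremalWeight hμ hN
  have hcard := card_fractionalIndices_extremalWeight_le N μ
  have hA1 := measureReal_abs_traceEstimator_sub_eq (ε := ε) hz hwt hpos (by linarith) fun v => by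
    rw [dotProduct_mulVec_eq_sum_eigenvalues hA.isHermitian, Finset.mul_sum]
    refine Finset.sum_congr rfl fun i _ => ?_
    rw [← mul_assoc, mul_div_cancel₀ _ hpos.ne']
  have hE := measureReal_abs_traceEstimator_sub_eq (ε := ε) hw hext
    (one_div_pos.2 (by linarith)) (by linarith) (dotProduct_extremalMatrix_mulVec N μ)
  rw [one_div_mul_cancel (by linarith), mul_one] at hE
  rw [htr, hA1, hE]
  constructor
  · obtain ⟨lam', h1, h2, h3⟩ := hx₀ n _ hwt
    rw [← h1.gammaTail_eq hext h2 hcard]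
    exact h3 _ ((le_max_left _ _).trans hx)
  · refine (hext.gammaTail_le_gammaMeasure hcard ((le_max_right _ _).trans hx)).trans ?_
    rw [show (m : ℝ) * μ / 2 = μ * (m / 2) by ring] at hX
    rw [show (m : ℝ) / 2 * μ = μ * (m / 2) by ring]
    exact gammaMeasure_one_le_of_hasLaw (by linarith) hX (by linarith)
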